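/- Let $d\ge 2$. Let $B_r\subset\mathbb{R}^d$ be the closed ball of radius $r$ centred at the origin, let $\sigma$ be the spherical Lebesgue measure on the unit sphere $S^{d-1}$, $\omega_d=\sigma(S^{d-1})$, and let $\sigma_{d-2}$ be the spherical Lebesgue measure on $S^{d-1}\cap e_d^\perp$, where $e_d$ is the last unit coordinate vector (the counting measure on two points if $d=2$). For $v_1,\dots,v_d\in\mathbb{R}^d$ let $[v_1,\dots,v_d]$ be the volume of the parallelepiped that they span. Let $\mu_{d-1}$ be the motion invariant measure on the space $A(d,d-1)$ of affine hyperplanes of $\mathbb{R}^d$ normalised by $$\int f\,\mathrm{d}\mu_{d-1}=\frac1{\omega_d}\int_{S^{d-1}}\int_{\mathbb{R}}f(u^\perp+su)\,\mathrm{d}s\,\sigma(\mathrm{d}u).$$ For $t>0$ let $\eta_t$ be a stationary and isotropic Poisson hyperplane process of intensity $t$, that is, a Poisson process on $A(d,d-1)$ with intensity measure $t\mu_{d-1}$. For $R>0$ let $$\Xi_{t,R}(\,\cdot\,)=\frac1{d!}\sum_{(H_1,\dots,H_d)}\mathbf{1}\{H_1\cap\dots\cap H_d\in\,\cdot\,\},$$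 the sum being over all $d$-tuples of distinct hyperplanes of $\eta_t$ that intersect $B_R$ (almost surely each such intersection is a single point), and let $L_{t,R}=\mathbb{E}\,\Xi_{t,R}(\,\cdot\,)$ be the intensity measure of this point process. Put $$C^{(1)}=\frac1{\omega_d^{\,d}}\int_{(S^{d-1})^d}[u_1,\dots,u_d]\,\sigma^{\otimes d}(\mathrm{d}(u_1,\dots,u_d)),$$ $$C^{(2)}=\frac1{\omega_d^{\,d}}\int_{[-1,1]^d}\int_{(S^{d-1}\cap e_d^\perp)^d}[u_1+z_1e_d,\dots,u_d+z_de_d]\,\sigma_{d-2}^{\otimes d}(\mathrm{d}(u_1,\dots,u_d))\,\mathrm{d}(z_1,\dots,z_d),$$ and $C_d=C^{(2)}/d!$. Let $M$ be the measure on $\mathbb{R}^d\setminus\{0\}$ with density $C_d\|x\|^{-(d+1)}$ with respect to the Lebesgue measure. There is a constant $C>0$ that depends only on $d$ such that the following holds. (1) For all $t,R>0$ the measure $L_{t,R}$ has a density $f_{t,R}\ge 0$ with respect to the Lebesgue measure such that, for all $x\in\mathbb{R}^d\setminus\{0\}$, $$f_{t,R}(x)=\mathbf{1}\{\|x\|<R\}\,\frac{C^{(1)}}{d!}\,t^d+\mathbf{1}\{\|x\|\ge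 R\}\Bigl(\frac{R}{\|x\|}\Bigr)^{d+1}t^d\Bigl[\frac{C^{(2)}}{d!}+\varepsilon_{t,R}(x)\Bigr],\qquad |\varepsilon_{t,R}(x)|\le C\,\frac{R^2}{\|x\|^2}\ \text{ if }\|x\|\ge R.$$ With $R=t^{-d/(d+1)}$, for every fixed $x\ne 0$, $f_{t,R}(x)\to C_d\|x\|^{-(d+1)}$ as $t\to\infty$. (2) Let $r>0$, and write $d_{\rm TV}(\mu,\nu)=\sup_A|\mu(A)-\nu(A)|$, the supremum being over all Borel sets $A$. If $t>0$ and $R=t^{-d/(d+1)}<r$, then the restrictions of $L_{t,R}$ and $M$ to $(B_r)^c=\mathbb{R}^d\setminus B_r$ are finite and $$d_{\rm TV}\bigl(L_{t,R}|_{(B_r)^c},\,M|_{(B_r)^c}\bigr)\le C\,t^{-\frac{2d}{d+1}}\,r^{-3}.$$ In particular, with $R=t^{-d/(d+1)}$, for every fixed $r>0$ this distance tends to $0$ as $t\to\infty$. -/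

import Mathlib

open MeasureTheory ProbabilityTheory Filter Topology
open scoped ENNReal NNReal

/-- The Euclidean space `ℝ^d`. -/
abbrev Euc (d : ℕ) : Type := EuclideanSpace ℝ (Fin d)

/-- The unit sphere `S^{d-1}` of `ℝ^d`. -/
abbrev USphere (d : ℕ) : Type := Metric.sphere (0 : Euc d) 1

/-- The spherical Lebesgue measure `σ` on `S^{d-1}`; for `d = 1` it is the counting measure on the
two-point set `S^0`. -/
noncomputable def sphereMeasure (d : ℕ) : Measure (USphere d) := (volume : Measure (Euc d)).toSphere

/-- The surface area `ω_d` of `S^{d-1}`. -/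
noncomputable def sphereArea (d : ℕ) : ℝ := (sphereMeasure d).real Set.univ

/-- The space `A(d,d-1)` of affine hyperplanes of `ℝ^d`. -/
def AffHyperplane (d : ℕ) : Type :=
  {H : AffineSubspace ℝ (Euc d) //
    (H : Set (Euc d)).Nonempty ∧ Module.finrank ℝ H.direction + 1 = d}

/-- The set of points of a hyperplane. -/
def AffHyperplane.points {d : ℕ} (H : AffHyperplane d) : Set (Euc d) := (H.1 : Set (Euc d))

/-- The hyperplane `H(u,s) = u^⊥ + s u = {x | ⟨u,x⟩ = s}` with unit normal vector `u` and signed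
distance `s` from the origin. -/
noncomputable def AffHyperplane.ofNormal {d : ℕ} (p : USphere d × ℝ) : AffHyperplane d :=
  ⟨AffineSubspace.mk' (p.2 • (p.1 : Euc d)) (Submodule.span ℝ {(p.1 : Euc d)})ᗮ,
    AffineSubspace.mk'_nonempty _ _, by
      have hu : (p.1 : Euc d) ≠ 0 := by
        intro h
        have h1 := p.1.2
        rw [mem_sphere_zero_iff_norm, h, norm_zero] at h1
        exact zero_ne_one h1
      have h := Submodule.finrank_add_finrank_orthogonal (Submodule.span ℝ {(p.1 : Euc d)})
      rw [finrank_span_singleton hu, finrank_euclideanSpace_fin] at h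
      rw [AffineSubspace.direction_mk']
      omega⟩

/-- The Borel σ-algebra of `A(d,d-1)`: a set of hyperplanes is measurable if and only if the set of
its parameters `(u,s)` is a Borel subset of `S^{d-1} × ℝ`. The usual topology of `A(d,d-1)` is the
quotient topology under the two-to-one map `(u,s) ↦ H(u,s)`, and its Borel sets are exactly
these. -/
noncomputable instance (d : ℕ) : MeasurableSpace (AffHyperplane d) :=
  MeasurableSpace.map AffHyperplane.ofNormal inferInstance

/-- The motion invariant measure `μ_{d-1}` on `A(d,d-1)`, normalised so that
`∫ f dμ_{d-1} = ω_d⁻¹ ∫_{S^{d-1}} ∫_ℝ f(H(u,s)) ds σ(du)`, i.e. as the integral of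
`∫_{L^⊥} f(L + y) dy` over the linear hyperplanes `L` with respect to the invariant probability
measure. -/
noncomputable def hyperplaneMeasure (d : ℕ) : Measure (AffHyperplane d) :=
  ((ENNReal.ofReal (sphereArea d))⁻¹ • (sphereMeasure d).prod (volume : Measure ℝ)).map
    AffHyperplane.ofNormal

/-- `η` is a Poisson (point) process with intensity measure `Λ`, given as a random set of points of
`X`: the number of points in a measurable set `B` is Poisson distributed with mean `Λ B` (and
almost surely infinite if `Λ B = ∞`), and the numbers of points in finitely many pairwise disjoint
measurable sets are independent. -/
structure IsPoissonProcess {Ω X : Type*} [MeasurableSpace Ω] [MeasurableSpace X]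
    (P : Measure Ω) (η : Ω → Set X) (Λ : Measure X) : Prop where
  measurable_count : ∀ B : Set X, MeasurableSet B → Measurable fun ω => (η ω ∩ B).encard
  law_count : ∀ B : Set X, MeasurableSet B → Λ B ≠ ∞ →
    ∀ k : ℕ, P {ω | (η ω ∩ B).encard = k} = poissonMeasure (Λ B).toNNReal {k}
  count_top : ∀ B : Set X, MeasurableSet B → Λ B = ∞ → ∀ᵐ ω ∂P, (η ω ∩ B).encard = ⊤
  indep_count : ∀ (n : ℕ) (B : Fin n → Set X), (∀ i, MeasurableSet (B i)) →
    Pairwise (fun i j => Disjoint (B i) (B j)) →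
    iIndepFun (fun i ω => (η ω ∩ B i).encard) P

/-- `η` is a stationary and isotropic Poisson hyperplane process in `ℝ^d` of intensity `t`. -/
def IsPoissonHyperplaneProcess {Ω : Type*} [MeasurableSpace Ω] {d : ℕ} (P : Measure Ω) (t : ℝ)
    (η : Ω → Set (AffHyperplane d)) : Prop :=
  IsPoissonProcess P η (ENNReal.ofReal t • hyperplaneMeasure d)

/-- The set `[B_R]` of hyperplanes that intersect the closed centred ball of radius `R`. -/
def hittingBall (d : ℕ) (R : ℝ) : Set (AffHyperplane d) :=
  {H | (H.points ∩ Metric.closedBall 0 R).Nonempty}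

/-- The intersection points of a set `S` of hyperplanes, as a measure:
`A ↦ (1/d!) ∑ 1{H_1 ∩ ⋯ ∩ H_d ∈ A}`, the sum being over all `d`-tuples of distinct elements of `S`
whose intersection is a single point. (In general position every `d`-tuple of distinct elements
has this property.) -/
noncomputable def intersectionPoints {d : ℕ} (S : Set (AffHyperplane d)) : Measure (Euc d) :=
  (Nat.factorial d : ℝ≥0∞)⁻¹ •
    Measure.sum fun p : {p : (Fin d → AffHyperplane d) × Euc d //
        Function.Injective p.1 ∧ (∀ i, p.1 i ∈ S) ∧ ⋂ i, (p.1 i).points = {p.2}} =>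
      Measure.dirac p.1.2

/-- The intersection point process `Ξ_{t,R}` of the hyperplanes of `η` that intersect `B_R`. -/
noncomputable def intersectionProcess {Ω : Type*} {d : ℕ} (η : Ω → Set (AffHyperplane d)) (R : ℝ)
    (ω : Ω) : Measure (Euc d) :=
  intersectionPoints (η ω ∩ hittingBall d R)

/-- The intensity measure `A ↦ 𝔼[Ξ(A)]` of a random measure `Ξ`. -/
noncomputable def intensityMeasure {Ω X : Type*} [MeasurableSpace Ω] [MeasurableSpace X]
    (P : Measure Ω) (Ξ : Ω → Measure X) : Measure X :=
  P.bind Ξ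

/-- The determinant `[u_1,…,u_d]`: the volume of the parallelepiped spanned by `u_1,…,u_d`. -/
noncomputable def subspaceDet {d : ℕ} (u : Fin d → Euc d) : ℝ :=
  (volume : Measure (Euc d)).real (parallelepiped u)

/-- The vector `u + z e_d` of `ℝ^d`, where `u ∈ ℝ^{d-1}` is viewed as an element of `e_d^⊥`. -/
noncomputable def addLast {d : ℕ} (u : Euc (d - 1)) (z : ℝ) : Euc d :=
  WithLp.toLp 2 fun i : Fin d => if h : (i : ℕ) < d - 1 then u ⟨i, h⟩ else z

/-- `C^{(1)}_{d,1} = ω_d^{-d} ∫_{(S^{d-1})^d} [u_1,…,u_d] σ^{⊗d}(du)`. -/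
noncomputable def innerConst (d : ℕ) : ℝ :=
  (sphereArea d ^ d)⁻¹ *
    ∫ u : Fin d → USphere d, subspaceDet (fun i => (u i : Euc d))
      ∂Measure.pi fun _ => sphereMeasure d

/-- `C^{(2)}_{d,1} = ω_d^{-d} ∫_{[-1,1]^d} ∫_{(S^{d-1} ∩ e_d^⊥)^d} [u_1 + z_1 e_d,…,u_d + z_d e_d]
σ_{d-2}^{⊗d}(du) dz`, where `S^{d-1} ∩ e_d^⊥` is identified with `S^{d-2}`. -/
noncomputable def outerConst (d : ℕ) : ℝ :=
  (sphereArea d ^ d)⁻¹ *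
    ∫ z in Set.Icc (-1 : Fin d → ℝ) 1,
      ∫ u : Fin d → USphere (d - 1), subspaceDet (fun i => addLast (u i : Euc (d - 1)) (z i))
        ∂Measure.pi fun _ => sphereMeasure (d - 1)

/-- The constant `C_d = C^{(2)}_{d,1} / d!`. -/
noncomputable def limitConst (d : ℕ) : ℝ := outerConst d / (Nat.factorial d : ℝ)

/-- The measure `M`, with Lebesgue density `C_d ‖x‖^{-(d+1)}`. -/
noncomputable def limitMeasure (d : ℕ) : Measure (Euc d) :=
  volume.withDensity fun x => ENNReal.ofReal (limitConst d / ‖x‖ ^ (d + 1))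

/-- The radius `t^{-d/(d+1)}`. -/
noncomputable def critRadius (d : ℕ) (t : ℝ) : ℝ := t ^ (-((d : ℝ) / ((d : ℝ) + 1)))

/-- The total variation distance `sup_A |μ(A) - ν(A)|` of two finite measures, the supremum being
over all measurable sets. -/
noncomputable def tvDistance {X : Type*} [MeasurableSpace X] (μ ν : Measure X) : ℝ≥0∞ :=
  ⨆ (A : Set X) (_ : MeasurableSet A), ENNReal.ofReal |μ.real A - ν.real A|

/-!
The argument has three independent parts.

**Reduction to a deterministic integral.** For a Poisson process with intensity measure `Λ`, the
mean number of `d`-tuples of distinct points that lie in a set is given by `Λ^d`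
(`IsPoissonProcess.bind_tupleMeasure`). Hence the intensity measure of the intersection process is
`1/d!` times the image, under the map that sends `d` hyperplanes to their common point, of the
`d`-th power of `t μ_{d-1}` restricted to the hyperplanes hitting `B_R`. With the normals
`u_1,…,u_d` fixed, the passage from the signed distances `s_i` to the solution `x` of
`⟨u_i, x⟩ = s_i` is linear with Jacobian `[u_1,…,u_d]`, so that there is the density
`f_{t,R}(x) = t^d / (d! ω_d^d) ∫ [u_1,…,u_d] 1{|⟨u_i, x⟩| ≤ R for all i} σ^d(du)`
(`pi_intersectionTuples`, `intersectionProcess_intensity`). For `‖x‖ ≤ R` the indicator is `1`.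

**The density for `‖x‖ > R`.** By rotation invariance `x = ‖x‖ e_d`. On the sphere use the
coordinates `u = (v + z e_d) / √(1 + z²)` with `v ∈ S^{d-2}`, `z ∈ ℝ`, in which `σ` has density
`(1 + z²)^{-d/2}` (`lintegral_sphere_succ`). With `h = R / ‖x‖`, the indicator becomes `|z_i| ≤ k`
for `k = h / √(1 - h²)`, and `[u_1,…,u_d]` is `[v_i + z_i e_d]` up to factors `(1 + z_i²)^{-1/2}`.
Scaling `z` by `k` turns the integral of `[v_i + z_i e_d]` over `|z_i| ≤ k` into `k^{d+1}` times the
double integral that defines `outerConst`. All weights lie between `1` and a power of `1 - h²`,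
which gives the two-sided estimate `normalIntegral_bounds` and so the relative error `O(h²)`
(`exists_abs_intersectionDensity_sub_le`).

**Total variation.** At the critical radius `R^{d+1} t^d = 1`, so the expansion compares `f_{t,R}`
with the density of `M` up to `C R² ‖x‖^{-(d+3)}`; the integral of this over `‖x‖ > r` is a
constant times `R² r^{-3}` (`tvDistance_critRadius_le`).
-/

/-! ### Factorial moment measures of Poisson processes -/

section Poisson

variable {Ω X Y : Type*} [MeasurableSpace Ω] [MeasurableSpace X]

/-- The counting measure on the `n`-tuples of distinct points of `S`. -/
noncomputable def tupleMeasure (n : ℕ) (S : Set X) : Measure (Fin n → X) :=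
  Measure.sum fun p : {p : Fin n → X // Function.Injective p ∧ ∀ i, p i ∈ S} => Measure.dirac p.1

theorem tupleMeasure_apply (n : ℕ) (S : Set X) {B : Set (Fin n → X)} (hB : MeasurableSet B) :
    tupleMeasure n S B = (({p | Function.Injective p ∧ ∀ i, p i ∈ S} ∩ B).encard : ℝ≥0∞) := by
  rw [tupleMeasure, Measure.sum_apply _ hB, ← ENNReal.tsum_set_one]
  simp_rw [Measure.dirac_apply' _ hB]
  rw [tsum_subtype ({p : Fin n → X | Function.Injective p ∧ ∀ i, p i ∈ S} ∩ B)
    (fun _ => (1 : ℝ≥0∞)), ← Set.indicator_indicator,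
    ← tsum_subtype {p : Fin n → X | Function.Injective p ∧ ∀ i, p i ∈ S}]
  rfl

theorem isFiniteMeasure_tupleMeasure (n : ℕ) {S : Set X} (hS : S.Finite) :
    IsFiniteMeasure (tupleMeasure n S) := by
  refine ⟨?_⟩
  rw [tupleMeasure_apply _ _ MeasurableSet.univ]
  have : (Set.univ.pi fun _ : Fin n => S).Finite := Set.Finite.pi fun _ => hS
  have h2 : ({p : Fin n → X | Function.Injective p ∧ ∀ i, p i ∈ S} ∩ Set.univ).Finite :=
    this.subset fun p hp => by simpa using hp.1.2
  rw [lt_top_iff_ne_top, Ne, ENat.toENNReal_eq_top]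
  exact h2.encard_lt_top.ne

theorem tupleMeasure_univ_pi {n : ℕ} {S : Set X} (hS : S.Finite) {A : Fin n → Set X}
    (hA : ∀ i, MeasurableSet (A i)) (hd : Pairwise fun i j => Disjoint (A i) (A j)) :
    tupleMeasure n S (Set.univ.pi A) = ∏ i, ((S ∩ A i).encard : ℝ≥0∞) := by
  rw [tupleMeasure_apply _ _ (MeasurableSet.univ_pi hA)]
  have h1 : {p : Fin n → X | Function.Injective p ∧ ∀ i, p i ∈ S} ∩ Set.univ.pi A
      = Set.univ.pi fun i => S ∩ A i := by
    ext p
    simp only [Set.mem_inter_iff, Set.mem_ofPred_eq, Set.mem_univ_pi]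
    refine ⟨fun h i => ⟨h.1.2 i, h.2 i⟩, fun h => ⟨⟨fun i j hij => ?_, fun i => (h i).1⟩,
      fun i => (h i).2⟩⟩
    by_contra hne
    exact Set.disjoint_left.1 (hd hne) (h i).2 (hij ▸ (h j).2)
  have hf : ∀ i, Finite ↑(S ∩ A i) := fun i => (hS.inter_of_left _).to_subtype
  have h2 : (Set.univ.pi fun i => S ∩ A i).encard = ∏ i, (S ∩ A i).encard := by
    have := ENat.card_congr (Equiv.Set.univPi fun i => S ∩ A i)
    rw [ENat.card_coe_set_eq, ENat.card_eq_coe_natCard, Nat.card_pi] at this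
    rw [this]
    push_cast
    refine Finset.prod_congr rfl fun i _ => ?_
    rw [← ENat.card_eq_coe_natCard, ENat.card_coe_set_eq]
  rw [h1, h2]
  exact map_prod ENat.toENNRealRingHom _ _

theorem tupleMeasure_restrict_injective (n : ℕ) (S : Set X)
    (hm : MeasurableSet {p : Fin n → X | Function.Injective p}) :
    (tupleMeasure n S).restrict {p | Function.Injective p} = tupleMeasure n S := by
  refine Measure.ext fun B hB => ?_
  rw [Measure.restrict_apply hB, tupleMeasure_apply _ _ (hB.inter hm), tupleMeasure_apply _ _ hB]
  congr 2
  ext p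
  simp only [Set.mem_inter_iff, Set.mem_ofPred_eq]
  tauto

/-- Injective tuples are covered by countably many boxes with pairwise disjoint sides. -/
theorem exists_cover_injective [TopologicalSpace Y] [T2Space Y] [SecondCountableTopology Y]
    [MeasurableSpace Y] [OpensMeasurableSpace Y] {e : X → Y} (he : Measurable e)
    (hinj : Function.Injective e) (n : ℕ) :
    ∃ Q : ℕ → Fin n → Set X, (∀ k i, MeasurableSet (Q k i)) ∧
      (∀ k, Pairwise fun i j => Disjoint (Q k i) (Q k j)) ∧
      {p : Fin n → X | Function.Injective p} = ⋃ k, Set.univ.pi (Q k) := by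
  let 𝓑 : Set (Set Y) := insert ∅ (TopologicalSpace.countableBasis Y)
  have h𝓑 : 𝓑.Countable := (TopologicalSpace.countable_countableBasis Y).insert _
  have hopen : ∀ b ∈ 𝓑, IsOpen b := by
    rintro b (rfl | hb)
    · exact isOpen_empty
    · exact TopologicalSpace.isOpen_of_mem_countableBasis hb
  let 𝒞 : Set (Fin n → Set Y) := {c | (∀ i, c i ∈ 𝓑) ∧ Pairwise fun i j => Disjoint (c i) (c j)}
  have h𝒞 : 𝒞.Countable :=
    (Set.countable_pi fun _ : Fin n => h𝓑).mono fun c hc i => hc.1 i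
  have hne : 𝒞.Nonempty := ⟨fun _ => ∅, fun _ => Or.inl rfl, fun _ _ _ => disjoint_bot_left⟩
  obtain ⟨c, hc⟩ := h𝒞.exists_eq_range hne
  have hc' : ∀ k, c k ∈ 𝒞 := fun k => hc ▸ Set.mem_range_self k
  refine ⟨fun k i => e ⁻¹' c k i, fun k i => he (hopen _ ((hc' k).1 i)).measurableSet,
    fun k i j hij => ((hc' k).2 hij).preimage e, ?_⟩
  ext p
  simp only [Set.mem_ofPred_eq, Set.mem_iUnion, Set.mem_univ_pi, Set.mem_preimage]
  constructor
  · intro hp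
    obtain ⟨U, hU, hdis⟩ := (Set.finite_range fun i => e (p i)).t2_separation
    have hb : ∀ i, ∃ b ∈ TopologicalSpace.countableBasis Y, e (p i) ∈ b ∧ b ⊆ U (e (p i)) :=
      fun i => (TopologicalSpace.isBasis_countableBasis Y).exists_subset_of_mem_open
        (hU (e (p i))).1 (hU (e (p i))).2
    choose b hb1 hb2 hb3 using hb
    have : b ∈ 𝒞 := ⟨fun i => Or.inr (hb1 i), fun i j hij =>
      (hdis (Set.mem_range_self i) (Set.mem_range_self j)
        fun h => hij (hp (hinj h))).mono (hb3 i) (hb3 j)⟩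
    rw [hc] at this
    obtain ⟨k, hk⟩ := this
    exact ⟨k, fun i => hk ▸ hb2 i⟩
  · rintro ⟨k, hk⟩ i j hij
    by_contra hne
    exact Set.disjoint_left.1 ((hc' k).2 hne) (hk i) (hij ▸ hk j)

theorem measurableSet_injective [TopologicalSpace Y] [T2Space Y] [SecondCountableTopology Y]
    [MeasurableSpace Y] [OpensMeasurableSpace Y] {e : X → Y} (he : Measurable e)
    (hinj : Function.Injective e) (n : ℕ) :
    MeasurableSet {p : Fin n → X | Function.Injective p} := by
  obtain ⟨Q, hQ, -, h⟩ := exists_cover_injective he hinj n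
  rw [h]
  exact MeasurableSet.iUnion fun k => MeasurableSet.univ_pi (hQ k)

theorem measurable_tupleMeasure [TopologicalSpace Y] [T2Space Y] [SecondCountableTopology Y]
    [MeasurableSpace Y] [OpensMeasurableSpace Y] {e : X → Y} (he : Measurable e)
    (hinj : Function.Injective e) (n : ℕ) {S : Ω → Set X} (hS : ∀ ω, (S ω).Finite)
    (hm : ∀ B, MeasurableSet B → Measurable fun ω => (S ω ∩ B).encard) :
    Measurable fun ω => tupleMeasure n (S ω) := by
  obtain ⟨Q, hQ, hd, hcov⟩ := exists_cover_injective he hinj n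
  have hQm : ∀ k, MeasurableSet (Set.univ.pi (Q k)) := fun k => MeasurableSet.univ_pi (hQ k)
  have hfin : ∀ ω, IsFiniteMeasure (tupleMeasure n (S ω)) :=
    fun ω => isFiniteMeasure_tupleMeasure n (hS ω)
  have hbox : ∀ k (A : Fin n → Set X), (∀ i, MeasurableSet (A i)) →
      Measurable fun ω => (tupleMeasure n (S ω)).restrict (Set.univ.pi (Q k)) (Set.univ.pi A) := by
    intro k A hA
    have : ∀ ω, (tupleMeasure n (S ω)).restrict (Set.univ.pi (Q k)) (Set.univ.pi A)
        = ∏ i, ((S ω ∩ (A i ∩ Q k i)).encard : ℝ≥0∞) := by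
      intro ω
      rw [Measure.restrict_apply (MeasurableSet.univ_pi hA), ← Set.pi_inter_distrib,
        tupleMeasure_univ_pi (hS ω) (fun i => (hA i).inter (hQ k i))]
      exact fun i j hij => (hd k hij).mono Set.inter_subset_right Set.inter_subset_right
    simp_rw [this]
    exact Finset.measurable_fun_prod _ fun i _ =>
      (measurable_of_countable ENat.toENNReal).comp (hm _ ((hA i).inter (hQ k i)))
  have hk : ∀ k, Measurable fun ω => (tupleMeasure n (S ω)).restrict (Set.univ.pi (Q k)) := by
    intro k
    refine Measurable.measure_of_isPiSystem generateFrom_pi.symm isPiSystem_pi ?_ ?_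
    · rintro _ ⟨A, hA, rfl⟩
      exact hbox k A fun i => hA i trivial
    · have := hbox k (fun _ => Set.univ) fun _ => MeasurableSet.univ
      rwa [Set.pi_univ] at this
  refine Measure.measurable_of_measurable_coe _ fun B hB => ?_
  have hDm := MeasurableSet.disjointed hQm
  have hsum : ∀ ω, tupleMeasure n (S ω) B = ∑' k, (tupleMeasure n (S ω)).restrict
      (Set.univ.pi (Q k)) (B ∩ disjointed (fun k => Set.univ.pi (Q k)) k) := by
    intro ω
    have h1 : tupleMeasure n (S ω) B =
        tupleMeasure n (S ω) (B ∩ ⋃ k, disjointed (fun k => Set.univ.pi (Q k)) k) := by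
      rw [iUnion_disjointed, ← hcov, ← Measure.restrict_apply hB,
        tupleMeasure_restrict_injective n (S ω) (measurableSet_injective he hinj n)]
    rw [h1, Set.inter_iUnion,
      measure_iUnion (fun i j hij => ((disjoint_disjointed _ hij).mono
        Set.inter_subset_right Set.inter_subset_right)) fun k => hB.inter (hDm k)]
    refine tsum_congr fun k => ?_
    rw [Measure.restrict_apply (hB.inter (hDm k)), Set.inter_eq_left.2
      (Set.inter_subset_right.trans (disjointed_subset (fun k => Set.univ.pi (Q k)) k))]
  simp_rw [hsum]
  exact Measurable.tsum fun k => (Measure.measurable_coe (hB.inter (hDm k))).comp (hk k)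

end Poisson

theorem lintegral_natCast_poissonMeasure (r : ℝ≥0) :
    ∫⁻ n : ℕ, (n : ℝ≥0∞) ∂poissonMeasure r = r := by
  have h1 : ∀ n : ℕ, ((n + 1 : ℕ) : ℝ≥0∞) * poissonMeasure r {n + 1}
      = r * poissonMeasure r {n} := by
    intro n
    rw [poissonMeasure_singleton, poissonMeasure_singleton, ← ENNReal.ofReal_natCast,
      ← ENNReal.ofReal_coe_nnreal, ← ENNReal.ofReal_mul (by positivity),
      ← ENNReal.ofReal_mul (by positivity), Nat.factorial_succ]
    congr 1
    push_cast
    field_simp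
    ring
  have h2 : ∑' n, poissonMeasure r {n} = 1 := by
    have := lintegral_countable' (μ := poissonMeasure r) fun _ => 1
    simpa using this.symm
  rw [lintegral_countable', tsum_eq_zero_add' ENNReal.summable]
  simp_rw [h1, ENNReal.tsum_mul_left, h2]
  simp

section Poisson

variable {Ω X Y : Type*} [MeasurableSpace Ω] [MeasurableSpace X]

namespace IsPoissonProcess

variable {P : Measure Ω} [IsProbabilityMeasure P] {η : Ω → Set X} {Λ : Measure X}

/-- The counts in sets of finite intensity are Poisson distributed; in particular they are almost
surely finite, since the Poisson probabilities of the natural numbers add up to `1`. -/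
theorem map_count (h : IsPoissonProcess P η Λ) {B : Set X} (hB : MeasurableSet B)
    (hΛ : Λ B ≠ ∞) :
    P.map (fun ω => (η ω ∩ B).encard) = (poissonMeasure (Λ B).toNNReal).map Nat.cast := by
  have hm := h.measurable_count B hB
  have : IsProbabilityMeasure (P.map (fun ω => (η ω ∩ B).encard)) :=
    Measure.isProbabilityMeasure_map hm.aemeasurable
  have hcast : Measurable (Nat.cast : ℕ → ℕ∞) := measurable_of_countable _
  have hinj : Function.Injective (Nat.cast : ℕ → ℕ∞) := Nat.cast_injective
  have hk : ∀ k : ℕ, P.map (fun ω => (η ω ∩ B).encard) {(k : ℕ∞)}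
      = poissonMeasure (Λ B).toNNReal {k} := fun k => by
    rw [Measure.map_apply hm (measurableSet_singleton _), ← h.law_count B hB hΛ k]
    rfl
  have hsum : ∑' n, poissonMeasure (Λ B).toNNReal {n} = 1 := by
    have := lintegral_countable' (μ := poissonMeasure (Λ B).toNNReal) fun _ => 1
    simpa using this.symm
  have hrange : P.map (fun ω => (η ω ∩ B).encard) (Set.range (Nat.cast : ℕ → ℕ∞)) = 1 := by
    rw [← Set.iUnion_singleton_eq_range, measure_iUnion]
    · simp_rw [hk, hsum]
    · intro i j hij
      simpa [Function.onFun] using hij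
    · exact fun _ => measurableSet_singleton _
  have htop : P.map (fun ω => (η ω ∩ B).encard) {⊤} = 0 := by
    refine measure_mono_null ?_ ((prob_compl_eq_zero_iff (MeasurableSet.of_discrete)).2 hrange)
    rintro x rfl ⟨n, hn⟩
    exact ENat.natCast_ne_top n hn
  refine Measure.ext_of_singleton fun a => ?_
  rw [Measure.map_apply hcast (measurableSet_singleton _)]
  induction a using ENat.recTopCoe with
  | top =>
    rw [htop]
    have : (Nat.cast : ℕ → ℕ∞) ⁻¹' {⊤} = ∅ := by
      ext n
      simp
    rw [this, measure_empty]
  | coe k =>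
    rw [hk k]
    congr 1
    ext n
    simp

/-- The mean number of points in `B` is `Λ B`. -/
theorem lintegral_count (h : IsPoissonProcess P η Λ) {B : Set X} (hB : MeasurableSet B)
    (hΛ : Λ B ≠ ∞) : ∫⁻ ω, ((η ω ∩ B).encard : ℝ≥0∞) ∂P = Λ B := by
  have hm := h.measurable_count B hB
  have h1 := lintegral_map (μ := P) (f := ENat.toENNReal) (measurable_of_countable _) hm
  rw [← h1, h.map_count hB hΛ,
    lintegral_map (measurable_of_countable _) (measurable_of_countable _)]
  simpa [ENNReal.coe_toNNReal hΛ] using lintegral_natCast_poissonMeasure (Λ B).toNNReal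

theorem ae_finite (h : IsPoissonProcess P η Λ) {B : Set X} (hB : MeasurableSet B)
    (hΛ : Λ B ≠ ∞) : ∀ᵐ ω ∂P, (η ω ∩ B).Finite := by
  have hm := h.measurable_count B hB
  have := ae_lt_top ((measurable_of_countable ENat.toENNReal).comp hm)
    (μ := P) (by simpa only [Function.comp_def, h.lintegral_count hB hΛ] using hΛ)
  filter_upwards [this] with ω hω
  rw [← Set.encard_lt_top_iff]
  simpa using hω

/-- On the tuples of distinct points, the factorial moment measure of a Poisson process is the
power of its intensity measure: both agree on boxes with pairwise disjoint sides, by the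
independence of the counts, and countably many such boxes cover the injective tuples. -/
theorem bind_tupleMeasure [TopologicalSpace Y] [T2Space Y] [SecondCountableTopology Y]
    [MeasurableSpace Y] [OpensMeasurableSpace Y] {e : X → Y} (he : Measurable e)
    (hinj : Function.Injective e) (h : IsPoissonProcess P η Λ) (n : ℕ) {W : Set X}
    (hW : MeasurableSet W) (hΛ : Λ W ≠ ∞) :
    AEMeasurable (fun ω => tupleMeasure n (η ω ∩ W)) P ∧
      P.bind (fun ω => tupleMeasure n (η ω ∩ W)) =
        (Measure.pi fun _ : Fin n => Λ.restrict W).restrict {p | Function.Injective p} := by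
  classical
  -- Off the null event of infinitely many points in `W`, the points in `W` form the finite set `S`.
  let S : Ω → Set X := fun ω => if (η ω ∩ W).Finite then η ω ∩ W else ∅
  have hS : ∀ ω, (S ω).Finite := by
    intro ω
    by_cases hω : (η ω ∩ W).Finite
    · simp only [S, hω, if_true]
    · simp only [S, hω, if_false, Set.finite_empty]
  have hSm : ∀ B, MeasurableSet B → Measurable fun ω => (S ω ∩ B).encard := by
    intro B hB
    have : (fun ω => (S ω ∩ B).encard) = fun ω =>
        if (η ω ∩ W).Finite then (η ω ∩ (W ∩ B)).encard else 0 := by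
      ext1 ω
      by_cases hω : (η ω ∩ W).Finite <;> simp [S, hω, Set.inter_assoc]
    rw [this]
    have hfin : MeasurableSet {ω | (η ω ∩ W).Finite} := by
      simp_rw [← Set.encard_ne_top_iff]
      exact h.measurable_count W hW (measurableSet_singleton ⊤).compl
    exact Measurable.ite hfin (h.measurable_count _ (hW.inter hB)) measurable_const
  have hae : S =ᵐ[P] fun ω => η ω ∩ W := by
    filter_upwards [h.ae_finite hW hΛ] with ω hω
    simp [S, hω]
  have hN := measurable_tupleMeasure he hinj n hS hSm
  have haeN : (fun ω => tupleMeasure n (S ω)) =ᵐ[P] fun ω => tupleMeasure n (η ω ∩ W) :=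
    hae.fun_comp (tupleMeasure n)
  refine ⟨⟨_, hN, haeN.symm⟩, ?_⟩
  rw [Measure.bind_congr_right haeN.symm]
  have hfinW : IsFiniteMeasure (Λ.restrict W) := ⟨by simpa using hΛ.lt_top⟩
  have him := measurableSet_injective he hinj n
  have h1 : (P.bind fun ω => tupleMeasure n (S ω)).restrict {p | Function.Injective p}
      = P.bind fun ω => tupleMeasure n (S ω) := by
    refine Measure.ext fun B hB => ?_
    rw [Measure.restrict_apply hB, Measure.bind_apply (hB.inter him) hN.aemeasurable,
      Measure.bind_apply hB hN.aemeasurable]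
    refine lintegral_congr fun ω => ?_
    rw [← Measure.restrict_apply hB, tupleMeasure_restrict_injective n _ him]
  rw [← h1]
  obtain ⟨Q, hQ, hd, hcov⟩ := exists_cover_injective he hinj n
  rw [hcov, Measure.restrict_iUnion_congr]
  intro k
  have hbox : ∀ A : Fin n → Set X, (∀ i, MeasurableSet (A i)) →
      (P.bind fun ω => tupleMeasure n (S ω)).restrict (Set.univ.pi (Q k)) (Set.univ.pi A) =
      (Measure.pi fun _ : Fin n => Λ.restrict W).restrict (Set.univ.pi (Q k)) (Set.univ.pi A) := by
    intro A hA
    have hAQ : ∀ i, MeasurableSet (A i ∩ Q k i) := fun i => (hA i).inter (hQ k i)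
    have hdis : Pairwise fun i j => Disjoint (A i ∩ Q k i) (A j ∩ Q k j) :=
      fun i j hij => (hd k hij).mono Set.inter_subset_right Set.inter_subset_right
    rw [Measure.restrict_apply (MeasurableSet.univ_pi hA), Measure.restrict_apply
      (MeasurableSet.univ_pi hA), ← Set.pi_inter_distrib, Measure.pi_pi,
      Measure.bind_apply (MeasurableSet.univ_pi hAQ) hN.aemeasurable]
    have h2 : ∀ᵐ ω ∂P, tupleMeasure n (S ω) (Set.univ.pi fun i => A i ∩ Q k i)
        = ∏ i, ((η ω ∩ (W ∩ (A i ∩ Q k i))).encard : ℝ≥0∞) := by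
      filter_upwards [hae] with ω hω
      rw [tupleMeasure_univ_pi (hS ω) hAQ hdis, hω]
      simp_rw [Set.inter_assoc]
    have hind := h.indep_count n (fun i => W ∩ (A i ∩ Q k i)) (fun i => hW.inter (hAQ i))
      fun i j hij => (hdis hij).mono Set.inter_subset_right Set.inter_subset_right
    have hind2 := hind.comp (fun _ => ENat.toENNReal) fun _ => measurable_of_countable _
    have h3 := lintegral_prod_eq_prod_lintegral_of_indepFun Finset.univ _ hind2
      fun i => (measurable_of_countable ENat.toENNReal).comp
        (h.measurable_count _ (hW.inter (hAQ i)))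
    rw [lintegral_congr_ae h2]
    refine h3.trans (Finset.prod_congr rfl fun i _ => ?_)
    refine (h.lintegral_count (hW.inter (hAQ i)) ?_).trans ?_
    · exact measure_ne_top_of_subset Set.inter_subset_left hΛ
    · rw [Measure.restrict_apply (hAQ i), Set.inter_comm]
  have huniv := hbox (fun _ => Set.univ) fun _ => MeasurableSet.univ
  rw [Set.pi_univ] at huniv
  have hfin : IsFiniteMeasure ((P.bind fun ω => tupleMeasure n (S ω)).restrict
      (Set.univ.pi (Q k))) := ⟨huniv ▸ measure_lt_top _ _⟩
  refine ext_of_generate_finite _ generateFrom_pi.symm isPiSystem_pi ?_ huniv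
  rintro _ ⟨A, hA, rfl⟩
  exact hbox A fun i => hA i trivial

end IsPoissonProcess

end Poisson

/-! ### Hyperplanes and their intersection points -/

section hyperplanes

open scoped Matrix

/-- The square matrix with rows `u_1,…,u_d`. -/
def rowMatrix {d : ℕ} (u : Fin d → Euc d) : Matrix (Fin d) (Fin d) ℝ := Matrix.of fun i j => u i j

theorem rowMatrix_mulVec {d : ℕ} (u : Fin d → Euc d) (x : Euc d) :
    rowMatrix u *ᵥ x.ofLp = fun i => inner ℝ (u i) x := by
  ext i
  simp [rowMatrix, Matrix.mulVec, dotProduct, PiLp.inner_apply, mul_comm]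

theorem subspaceDet_eq_abs_det {d : ℕ} (u : Fin d → Euc d) :
    subspaceDet u = |(rowMatrix u).det| := by
  have h := Measure.addHaar_parallelepiped (EuclideanSpace.basisFun (Fin d) ℝ).toBasis u
  rw [OrthonormalBasis.addHaar_eq_volume] at h
  rw [subspaceDet, measureReal_def, h, ENNReal.toReal_ofReal (abs_nonneg _), Module.Basis.det_apply,
    ← Matrix.det_transpose]
  congr 2

theorem norm_USphere {d : ℕ} (u : USphere d) : ‖(u : Euc d)‖ = 1 := mem_sphere_zero_iff_norm.1 u.2

namespace AffHyperplane

variable {d : ℕ}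

theorem mem_points_ofNormal {p : USphere d × ℝ} {x : Euc d} :
    x ∈ (ofNormal p).points ↔ inner ℝ (p.1 : Euc d) x = p.2 := by
  rw [points, ofNormal, SetLike.mem_coe, AffineSubspace.mem_mk', vsub_eq_sub,
    Submodule.mem_orthogonal_singleton_iff_inner_right, inner_sub_right, inner_smul_right,
    real_inner_self_eq_norm_sq, norm_USphere]
  norm_num [sub_eq_zero]

theorem ofNormal_neg (p : USphere d × ℝ) : ofNormal (-p) = ofNormal p := by
  refine Subtype.ext (SetLike.coe_injective (Set.ext fun x => ?_))
  refine mem_points_ofNormal.trans (Iff.trans ?_ mem_points_ofNormal.symm)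
  simp

theorem eq_or_eq_neg_of_ofNormal_eq {p q : USphere d × ℝ} (h : ofNormal p = ofNormal q) :
    q = p ∨ q = -p := by
  have hdir : (Submodule.span ℝ {(p.1 : Euc d)})ᗮ = (Submodule.span ℝ {(q.1 : Euc d)})ᗮ := by
    have := congrArg (fun H : AffHyperplane d => H.1.direction) h
    simpa only [ofNormal, AffineSubspace.direction_mk'] using this
  have hq : (q.1 : Euc d) ∈ Submodule.span ℝ {(p.1 : Euc d)} := by
    rw [← Submodule.orthogonal_orthogonal (Submodule.span ℝ {(p.1 : Euc d)}), hdir,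
      Submodule.orthogonal_orthogonal]
    exact Submodule.mem_span_singleton_self _
  obtain ⟨c, hc⟩ := Submodule.mem_span_singleton.1 hq
  have hc1 : |c| = 1 := by
    have := norm_USphere q.1
    rwa [← hc, norm_smul, norm_USphere, mul_one, Real.norm_eq_abs] at this
  have hmem : p.2 • (p.1 : Euc d) ∈ (ofNormal q).points := by
    rw [← h, mem_points_ofNormal, inner_smul_right, real_inner_self_eq_norm_sq, norm_USphere]
    norm_num
  rw [mem_points_ofNormal, inner_smul_right, ← hc, real_inner_smul_left,
    real_inner_self_eq_norm_sq, norm_USphere] at hmem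
  rcases eq_or_eq_neg_of_abs_eq hc1 with rfl | rfl
  · left
    exact Prod.ext (Subtype.ext (by simpa using hc.symm)) (by linarith)
  · right
    refine Prod.ext (Subtype.ext ?_) ?_
    · simpa using hc.symm
    · simp only [Prod.snd_neg]
      linarith

theorem ofNormal_surjective : Function.Surjective (ofNormal (d := d)) := by
  rintro ⟨H, ⟨x, hx⟩, hH⟩
  have hfr : Module.finrank ℝ H.directionᗮ = 1 := by
    have := Submodule.finrank_add_finrank_orthogonal H.direction
    rw [finrank_euclideanSpace_fin] at this
    omega
  obtain ⟨v, hv, hv0⟩ := (Submodule.ne_bot_iff _).1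
    (fun h : H.directionᗮ = ⊥ => by rw [h, finrank_bot] at hfr; omega)
  have hspan : Submodule.span ℝ {v} = H.directionᗮ := by
    refine Submodule.eq_of_le_of_finrank_eq ((Submodule.span_singleton_le_iff_mem _ _).2 hv) ?_
    rw [hfr, finrank_span_singleton hv0]
  have hn : ‖v‖ ≠ 0 := norm_ne_zero_iff.2 hv0
  let u : USphere d := ⟨‖v‖⁻¹ • v, by
    rw [mem_sphere_zero_iff_norm, norm_smul, norm_inv, norm_norm, inv_mul_cancel₀ hn]⟩
  have hu : Submodule.span ℝ {(u : Euc d)} = H.directionᗮ := by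
    rw [← hspan]
    exact Submodule.span_singleton_smul_eq (IsUnit.mk0 _ (inv_ne_zero hn)) v
  refine ⟨(u, inner ℝ (u : Euc d) x),
    Subtype.ext (AffineSubspace.ext_of_direction_eq ?_ ⟨x, ?_, hx⟩)⟩
  · simp only [ofNormal, AffineSubspace.direction_mk', hu, Submodule.orthogonal_orthogonal]
  · exact mem_points_ofNormal.2 rfl

theorem measurable_ofNormal : Measurable (ofNormal (d := d)) := fun _ h => h

/-- Every hyperplane has two parameters `±(u, s)`; a measurable choice among them is made by
comparing the values of an injective measurable function `S^{d-1} → ℝ` at `u` and `-u`. -/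
theorem exists_measurable_section :
    ∃ e : AffHyperplane d → USphere d × ℝ, Measurable e ∧ ∀ H, ofNormal (e H) = H := by
  classical
  have : StandardBorelSpace (USphere d) := Metric.isClosed_sphere.measurableSet.standardBorel
  let φ : USphere d → ℝ := embeddingReal (USphere d)
  have hφ : MeasurableEmbedding φ := measurableEmbedding_embeddingReal _
  have hne : ∀ u : USphere d, φ u ≠ φ (-u) := fun u h => by
    have h1 := congrArg (Subtype.val) (hφ.injective h)
    have h2 : (u : Euc d) = 0 := by
      have h0 : (2 : ℝ) • (u : Euc d) = 0 := by
        rw [two_smul]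
        exact eq_neg_iff_add_eq_zero.1 h1
      exact (smul_eq_zero.1 h0).resolve_left two_ne_zero
    have h3 := norm_USphere u
    simp [h2] at h3
  let c : USphere d × ℝ → USphere d × ℝ := fun p => if φ (-p.1) < φ p.1 then p else -p
  have hneg : Measurable (fun u : USphere d => -u) := continuous_neg.measurable
  have hc : Measurable c := by
    refine Measurable.ite (measurableSet_lt ?_ ?_) measurable_id ?_
    · exact hφ.measurable.comp (hneg.comp measurable_fst)
    · exact hφ.measurable.comp measurable_fst
    · exact (hneg.comp measurable_fst).prodMk measurable_snd.neg
  have hcneg : ∀ p, c (-p) = c p := by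
    intro p
    rcases lt_or_gt_of_ne (hne p.1) with h | h
    · simp [c, h, h.not_gt]
    · simp [c, h, h.not_gt]
  have hcof : ∀ p, ofNormal (c p) = ofNormal p := by
    intro p
    by_cases h : φ (-p.1) < φ p.1 <;> simp [c, h, ofNormal_neg]
  choose g hg using ofNormal_surjective (d := d)
  refine ⟨fun H => c (g H), fun B hB => ?_, fun H => by rw [hcof, hg]⟩
  have : ofNormal ⁻¹' ((fun H => c (g H)) ⁻¹' B) = c ⁻¹' B := by
    ext p
    simp only [Set.mem_preimage]
    rcases eq_or_eq_neg_of_ofNormal_eq (hg (ofNormal p)).symm with h | h <;> simp [h, hcneg]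
  change MeasurableSet (ofNormal ⁻¹' ((fun H => c (g H)) ⁻¹' B))
  rw [this]
  exact hc hB

theorem ofNormal_mem_hittingBall {p : USphere d × ℝ} {R : ℝ} :
    ofNormal p ∈ hittingBall d R ↔ |p.2| ≤ R := by
  constructor
  · rintro ⟨x, hx, hxR⟩
    rw [← mem_points_ofNormal.1 hx]
    refine (abs_real_inner_le_norm _ _).trans ?_
    rw [norm_USphere, one_mul]
    simpa using hxR
  · intro h
    refine ⟨p.2 • (p.1 : Euc d), ?_, ?_⟩
    · rw [mem_points_ofNormal, inner_smul_right, real_inner_self_eq_norm_sq, norm_USphere]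
      norm_num
    · rw [mem_closedBall_zero_iff, norm_smul, norm_USphere, mul_one]
      exact h

theorem measurableSet_hittingBall (R : ℝ) : MeasurableSet (hittingBall d R) := by
  change MeasurableSet (ofNormal ⁻¹' hittingBall d R)
  simp_rw [Set.preimage, ofNormal_mem_hittingBall]
  exact measurableSet_le measurable_snd.abs measurable_const

/-- Hyperplanes with normals `u_i` meet in the single point `x` if and only if the `u_i` are
linearly independent and `x` solves the linear system `⟨u_i, x⟩ = s_i`. -/
theorem iInter_points_ofNormal_eq_singleton {p : Fin d → USphere d × ℝ} {x : Euc d} :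
    ⋂ i, (ofNormal (p i)).points = {x} ↔
      (rowMatrix fun i => ((p i).1 : Euc d)).det ≠ 0 ∧
        (rowMatrix fun i => ((p i).1 : Euc d)) *ᵥ x.ofLp = fun i => (p i).2 := by
  set M := rowMatrix fun i => ((p i).1 : Euc d)
  have hmem : ∀ y : Euc d, y ∈ ⋂ i, (ofNormal (p i)).points ↔ M *ᵥ y.ofLp = fun i => (p i).2 := by
    intro y
    rw [rowMatrix_mulVec, funext_iff, Set.mem_iInter]
    exact forall_congr' fun i => mem_points_ofNormal
  constructor
  · intro h
    have hx : M *ᵥ x.ofLp = fun i => (p i).2 := (hmem x).1 (h ▸ rfl)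
    refine ⟨fun hdet => ?_, hx⟩
    obtain ⟨v, hv0, hv⟩ := Matrix.exists_mulVec_eq_zero_iff.2 hdet
    have : x + WithLp.toLp 2 v ∈ ⋂ i, (ofNormal (p i)).points := by
      rw [hmem, WithLp.ofLp_add, Matrix.mulVec_add, hx, hv, add_zero]
    rw [h, Set.mem_singleton_iff, add_eq_left] at this
    exact hv0 (by simpa using congrArg WithLp.ofLp this)
  · rintro ⟨hdet, hx⟩
    ext y
    rw [hmem, Set.mem_singleton_iff]
    refine ⟨fun hy => ?_, fun h => h ▸ hx⟩
    refine WithLp.ofLp_injective 2 (Matrix.mulVec_injective_of_isUnit ?_ (hy.trans hx.symm))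
    exact (Matrix.isUnit_iff_isUnit_det _).2 (IsUnit.mk0 _ hdet)

end AffHyperplane

/-- The solution `x` of the linear system `⟨u_i, x⟩ = s_i` by Cramer's rule, and `0` if the `u_i`
are linearly dependent. -/
noncomputable def cramerSolution {d : ℕ} (p : Fin d → USphere d × ℝ) : Euc d :=
  ((rowMatrix fun i => ((p i).1 : Euc d)).det)⁻¹ •
    WithLp.toLp 2 ((rowMatrix fun i => ((p i).1 : Euc d)).adjugate *ᵥ fun i => (p i).2)

theorem continuous_rowMatrix {d : ℕ} {T : Type*} [TopologicalSpace T] {u : T → Fin d → Euc d}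
    (hu : ∀ i, Continuous fun t => u t i) : Continuous fun t => rowMatrix (u t) :=
  continuous_matrix fun i j => (EuclideanSpace.proj (𝕜 := ℝ) j).continuous.comp (hu i)

theorem measurable_cramerSolution {d : ℕ} : Measurable (cramerSolution (d := d)) := by
  have hM : Continuous fun p : Fin d → USphere d × ℝ => rowMatrix fun i => ((p i).1 : Euc d) :=
    continuous_rowMatrix fun i => by fun_prop
  refine Measurable.smul (f := fun p : Fin d → USphere d × ℝ => _) hM.matrix_det.measurable.inv ?_
  refine Continuous.measurable ((PiLp.continuous_toLp 2 _).comp ?_)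
  exact hM.matrix_adjugate.matrix_mulVec (by fun_prop)

theorem mulVec_eq_iff_cramerSolution {d : ℕ} {p : Fin d → USphere d × ℝ} {x : Euc d}
    (h : (rowMatrix fun i => ((p i).1 : Euc d)).det ≠ 0) :
    (rowMatrix fun i => ((p i).1 : Euc d)) *ᵥ x.ofLp = (fun i => (p i).2) ↔
      x = cramerSolution p := by
  set M := rowMatrix fun i => ((p i).1 : Euc d) with hM
  have hsol : M *ᵥ (cramerSolution p).ofLp = fun i => (p i).2 := by
    rw [cramerSolution, ← hM, WithLp.ofLp_smul, Matrix.mulVec_smul, Matrix.mulVec_mulVec,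
      Matrix.mul_adjugate, Matrix.smul_mulVec, Matrix.one_mulVec, inv_smul_smul₀ h]
  refine ⟨fun hx => ?_, fun hx => hx ▸ hsol⟩
  refine WithLp.ofLp_injective 2 (Matrix.mulVec_injective_of_isUnit ?_ (hx.trans hsol.symm))
  exact (Matrix.isUnit_iff_isUnit_det _).2 (IsUnit.mk0 _ h)

section intersectionTuples

variable {d : ℕ}

/-- The `d`-tuples of hyperplanes that intersect in a single point, which belongs to `A`. -/
def intersectionTuples (A : Set (Euc d)) : Set (Fin d → AffHyperplane d) :=
  {H | ∃ x ∈ A, ⋂ i, (H i).points = {x}}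

theorem ofNormal_mem_intersectionTuples {A : Set (Euc d)} {p : Fin d → USphere d × ℝ} :
    (fun i => AffHyperplane.ofNormal (p i)) ∈ intersectionTuples A ↔
      (rowMatrix fun i => ((p i).1 : Euc d)).det ≠ 0 ∧ cramerSolution p ∈ A := by
  simp only [intersectionTuples, Set.mem_ofPred_eq,
    AffHyperplane.iInter_points_ofNormal_eq_singleton]
  constructor
  · rintro ⟨x, hx, hdet, h⟩
    exact ⟨hdet, (mulVec_eq_iff_cramerSolution hdet).1 h ▸ hx⟩
  · rintro ⟨hdet, h⟩
    exact ⟨_, h, hdet, (mulVec_eq_iff_cramerSolution hdet).2 rfl⟩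

theorem measurableSet_intersectionTuples {A : Set (Euc d)} (hA : MeasurableSet A) :
    MeasurableSet (intersectionTuples A) := by
  obtain ⟨e, he, hofe⟩ := AffHyperplane.exists_measurable_section (d := d)
  have hM : Continuous fun p : Fin d → USphere d × ℝ => rowMatrix fun i => ((p i).1 : Euc d) :=
    continuous_rowMatrix fun i => by fun_prop
  have : intersectionTuples A = (fun H : Fin d → AffHyperplane d => fun i => e (H i)) ⁻¹'
      {p | (rowMatrix fun i => ((p i).1 : Euc d)).det ≠ 0 ∧ cramerSolution p ∈ A} := by
    ext H
    rw [Set.mem_preimage, Set.mem_ofPred_eq, ← ofNormal_mem_intersectionTuples]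
    simp_rw [hofe]
  rw [this]
  refine measurable_pi_lambda _ (fun i => he.comp (measurable_pi_apply i))
    (MeasurableSet.inter ?_ ?_)
  · exact hM.matrix_det.measurable (measurableSet_singleton (0 : ℝ)).compl
  · exact measurable_cramerSolution hA

theorem intersectionPoints_apply (S : Set (AffHyperplane d)) {A : Set (Euc d)}
    (hA : MeasurableSet A) :
    intersectionPoints S A =
      (Nat.factorial d : ℝ≥0∞)⁻¹ * tupleMeasure d S (intersectionTuples A) := by
  rw [intersectionPoints, Measure.smul_apply, smul_eq_mul, Measure.sum_apply _ hA,
    tupleMeasure_apply _ _ (measurableSet_intersectionTuples hA)]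
  congr 1
  simp_rw [Measure.dirac_apply' _ hA]
  let T : Set ((Fin d → AffHyperplane d) × Euc d) :=
    {p | Function.Injective p.1 ∧ (∀ i, p.1 i ∈ S) ∧ ⋂ i, (p.1 i).points = {p.2}}
  have h1 : ∑' p : T, A.indicator (1 : Euc d → ℝ≥0∞) p.1.2 =
      ((T ∩ Prod.snd ⁻¹' A).encard : ℝ≥0∞) := by
    rw [← ENNReal.tsum_set_one, tsum_subtype (T ∩ Prod.snd ⁻¹' A) (fun _ => (1 : ℝ≥0∞)),
      ← Set.indicator_indicator, ← tsum_subtype T]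
    rfl
  refine h1.trans ?_
  have hinj : Set.InjOn Prod.fst (T ∩ Prod.snd ⁻¹' A) := by
    rintro ⟨p, x⟩ ⟨⟨-, -, h⟩, -⟩ ⟨q, y⟩ ⟨⟨-, -, h'⟩, -⟩ hpq
    obtain rfl : p = q := hpq
    exact Prod.ext rfl (Set.singleton_injective (h.symm.trans h'))
  rw [← hinj.encard_image]
  congr 2
  ext p
  simp only [Set.mem_image, Set.mem_inter_iff, Set.mem_ofPred_eq, Set.mem_preimage, T,
    intersectionTuples, Prod.exists, exists_and_right, exists_eq_right]
  constructor
  · rintro ⟨x, ⟨h1, h2, h3⟩, h4⟩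
    exact ⟨⟨h1, h2⟩, x, h4, h3⟩
  · rintro ⟨⟨h1, h2⟩, x, h4, h3⟩
    exact ⟨x, ⟨h1, h2, h3⟩, h4⟩

theorem injective_of_mem_intersectionTuples {A : Set (Euc d)} {H : Fin d → AffHyperplane d}
    (h : H ∈ intersectionTuples A) : Function.Injective H := by
  obtain ⟨e, -, hofe⟩ := AffHyperplane.exists_measurable_section (d := d)
  obtain ⟨x, -, hx⟩ := h
  have hdet := (AffHyperplane.iInter_points_ofNormal_eq_singleton (p := fun i => e (H i))).1
    (by simpa only [hofe] using hx)
  intro i j hij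
  by_contra hne
  refine hdet.1 (Matrix.det_zero_of_row_eq hne ?_)
  ext k
  simp [rowMatrix, hij]

/-- The intersection point measure is a measurable function of the tuple measure, which makes it a
random measure. -/
theorem exists_measurable_intersectionPoints :
    ∃ Ψ : Measure (Fin d → AffHyperplane d) → Measure (Euc d),
      Measurable Ψ ∧ ∀ S, intersectionPoints S = Ψ (tupleMeasure d S) := by
  obtain ⟨e, he, hofe⟩ := AffHyperplane.exists_measurable_section (d := d)
  let T : (Fin d → AffHyperplane d) → Euc d := fun H => cramerSolution fun i => e (H i)
  have hT : Measurable T := measurable_cramerSolution.comp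
    (measurable_pi_lambda _ fun i => he.comp (measurable_pi_apply i))
  have hG := measurableSet_intersectionTuples (d := d) MeasurableSet.univ
  have happ : ∀ (ν : Measure (Fin d → AffHyperplane d)) (A : Set (Euc d)), MeasurableSet A →
      ((Nat.factorial d : ℝ≥0∞)⁻¹ • (ν.restrict (intersectionTuples Set.univ)).map T) A =
        (Nat.factorial d : ℝ≥0∞)⁻¹ * ν (intersectionTuples A) := by
    intro ν A hA
    rw [Measure.smul_apply, smul_eq_mul, Measure.map_apply hT hA, Measure.restrict_apply (hT hA)]
    congr 2
    ext H
    have key : ∀ B : Set (Euc d), H ∈ intersectionTuples B ↔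
        (rowMatrix fun i => ((e (H i)).1 : Euc d)).det ≠ 0 ∧ T H ∈ B := fun B => by
      rw [← ofNormal_mem_intersectionTuples]
      simp_rw [hofe]
    rw [Set.mem_inter_iff, key, key, Set.mem_preimage]
    simp [and_comm]
  refine ⟨fun ν => (Nat.factorial d : ℝ≥0∞)⁻¹ • (ν.restrict (intersectionTuples Set.univ)).map T,
    ?_, fun S => Measure.ext fun A hA => ?_⟩
  · refine Measure.measurable_of_measurable_coe _ fun A hA => ?_
    simp_rw [happ _ A hA]
    exact (Measure.measurable_coe (measurableSet_intersectionTuples hA)).const_mul _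
  · rw [happ _ A hA, intersectionPoints_apply S hA]

end intersectionTuples

theorem sphereArea_pos {d : ℕ} (hd : 1 ≤ d) : 0 < sphereArea d := by
  have : Nonempty (Fin d) := ⟨⟨0, hd⟩⟩
  rw [sphereArea, sphereMeasure, Measure.toSphere_real_apply_univ, finrank_euclideanSpace_fin]
  have h1 : (0 : ℝ) < d := by exact_mod_cast hd
  have h2 : 0 < (volume : Measure (Euc d)).real (Metric.ball 0 1) :=
    ENNReal.toReal_pos (Metric.isOpen_ball.measure_ne_zero _ ⟨0, by simp⟩)
      measure_ball_lt_top.ne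
  positivity

instance (d : ℕ) : IsFiniteMeasure (sphereMeasure d) :=
  inferInstanceAs (IsFiniteMeasure (volume : Measure (Euc d)).toSphere)

/-- The set of hyperplanes hitting `B_R` is parametrised by `S^{d-1} × [-R, R]`. -/
theorem smul_hyperplaneMeasure_restrict_hittingBall (d : ℕ) (a : ℝ≥0∞) (R : ℝ) :
    (a • hyperplaneMeasure d).restrict (hittingBall d R) =
      ((sphereMeasure d).prod ((a * (ENNReal.ofReal (sphereArea d))⁻¹) •
        (volume : Measure ℝ).restrict (Set.Icc (-R) R))).map AffHyperplane.ofNormal := by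
  have h1 : AffHyperplane.ofNormal ⁻¹' hittingBall d R = Set.univ ×ˢ Set.Icc (-R) R := by
    ext p
    simp only [Set.mem_preimage, AffHyperplane.ofNormal_mem_hittingBall, Set.mem_prod,
      Set.mem_univ, true_and, Set.mem_Icc, abs_le]
  rw [hyperplaneMeasure, Measure.restrict_smul, Measure.restrict_map
    AffHyperplane.measurable_ofNormal (AffHyperplane.measurableSet_hittingBall R), h1,
    Measure.restrict_smul, ← Measure.prod_restrict, Measure.restrict_univ, Measure.map_smul,
    smul_smul, Measure.prod_smul_right, Measure.map_smul]

section density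

variable {d : ℕ}

/-- The parameters of the hyperplanes with given normals whose intersection point lies in `A`. -/
theorem volume_setOf_cramerSolution_mem (u : Fin d → USphere d) (R : ℝ) (A : Set (Euc d)) :
    volume ({s : Fin d → ℝ | (rowMatrix fun i => (u i : Euc d)).det ≠ 0 ∧
      cramerSolution (fun i => (u i, s i)) ∈ A} ∩ Set.univ.pi fun _ => Set.Icc (-R) R) =
    ENNReal.ofReal (subspaceDet fun i => (u i : Euc d)) *
      volume (A ∩ {x | ∀ i, |inner ℝ (u i : Euc d) x| ≤ R}) := by
  set M := rowMatrix fun i => (u i : Euc d) with hM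
  by_cases hdet : M.det = 0
  · simp [hdet, subspaceDet_eq_abs_det, ← hM]
  have h1 : {s : Fin d → ℝ | M.det ≠ 0 ∧
      cramerSolution (fun i => (u i, s i)) ∈ A} ∩ Set.univ.pi (fun _ => Set.Icc (-R) R) =
      Matrix.toLin' M '' ((WithLp.toLp 2) ⁻¹' (A ∩ {x | ∀ i, |inner ℝ (u i : Euc d) x| ≤ R})) := by
    ext s
    simp only [Set.mem_inter_iff, Set.mem_ofPred_eq, Set.mem_univ_pi, Set.mem_image,
      Set.mem_preimage, Matrix.toLin'_apply, Set.mem_Icc, ← abs_le]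
    constructor
    · rintro ⟨⟨-, hs⟩, hR⟩
      have h2 := (mulVec_eq_iff_cramerSolution (p := fun i => (u i, s i)) hdet).2 rfl
      have h3 := rowMatrix_mulVec (fun i => (u i : Euc d)) (cramerSolution fun i => (u i, s i))
      refine ⟨(cramerSolution fun i => (u i, s i)).ofLp, ⟨hs, fun i => ?_⟩, h2⟩
      have h4 := congrFun (h3.symm.trans h2) i
      simp only at h4
      rw [WithLp.toLp_ofLp, h4]
      exact hR i
    · rintro ⟨y, ⟨hyA, hyR⟩, rfl⟩
      have h2 := (mulVec_eq_iff_cramerSolution (p := fun i => (u i, (M *ᵥ y) i))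
        (x := WithLp.toLp 2 y) hdet).1 rfl
      refine ⟨⟨hdet, h2 ▸ hyA⟩, fun i => ?_⟩
      have h3 := congrFun (rowMatrix_mulVec (fun i => (u i : Euc d)) (WithLp.toLp 2 y)) i
      simp only at h3
      exact h3 ▸ hyR i
  rw [h1, Measure.addHaar_image_linearMap, LinearMap.det_toLin', subspaceDet_eq_abs_det, ← hM]
  congr 1
  exact (EuclideanSpace.volume_preserving_symm_measurableEquiv_toLp
    (Fin d)).symm.measure_preimage_equiv _

/-- The integral of `[u_1,…,u_d]` over the unit normals of those hyperplanes through `x` that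
intersect `B_R`. -/
noncomputable def normalIntegral (d : ℕ) (R : ℝ) (x : Euc d) : ℝ≥0∞ :=
  ∫⁻ u : Fin d → USphere d, {u : Fin d → USphere d | ∀ i, |inner ℝ (u i : Euc d) x| ≤ R}.indicator
    (fun u => ENNReal.ofReal (subspaceDet fun i => (u i : Euc d))) u
      ∂Measure.pi fun _ => sphereMeasure d

theorem continuous_subspaceDet {T : Type*} [TopologicalSpace T] {u : T → Fin d → Euc d}
    (hu : ∀ i, Continuous fun t => u t i) : Continuous fun t => subspaceDet (u t) := by
  simp_rw [subspaceDet_eq_abs_det]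
  exact (continuous_rowMatrix hu).matrix_det.abs

theorem measurable_normalIntegrand (R : ℝ) :
    Measurable fun q : Euc d × (Fin d → USphere d) =>
      {u : Fin d → USphere d | ∀ i, |inner ℝ (u i : Euc d) q.1| ≤ R}.indicator
        (fun u => ENNReal.ofReal (subspaceDet fun i => (u i : Euc d))) q.2 := by
  have h1 : MeasurableSet {q : Euc d × (Fin d → USphere d) |
      ∀ i, |inner ℝ (q.2 i : Euc d) q.1| ≤ R} := by
    simp only [Set.ofPred_forall]
    refine MeasurableSet.iInter fun i => (isClosed_le ?_ continuous_const).measurableSet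
    fun_prop
  have h2 : Measurable fun q : Euc d × (Fin d → USphere d) =>
      ENNReal.ofReal (subspaceDet fun i => (q.2 i : Euc d)) :=
    (continuous_subspaceDet fun i => by fun_prop).measurable.ennreal_ofReal
  exact h2.indicator h1

theorem measurable_normalIntegral (R : ℝ) : Measurable (normalIntegral d R) :=
  (measurable_normalIntegrand R).lintegral_prod_right'

theorem pi_smul_restrict_Icc (k : ℝ≥0∞) (hk : k ≠ ∞) (R : ℝ) :
    (Measure.pi fun _ : Fin d => k • (volume : Measure ℝ).restrict (Set.Icc (-R) R)) =
      k ^ d • (volume : Measure (Fin d → ℝ)).restrict (Set.univ.pi fun _ => Set.Icc (-R) R) := by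
  have : IsFiniteMeasure (k • (volume : Measure ℝ).restrict (Set.Icc (-R) R)) :=
    Measure.smul_finite _ hk
  refine Measure.pi_eq fun s hs => ?_
  rw [volume_pi, Measure.restrict_pi_pi, Measure.smul_apply, Measure.pi_pi]
  simp [Finset.prod_mul_distrib]

/-- The intensity measure of the intersection process has a density that is proportional to
`normalIntegral`: for fixed normals, the change of variables from the signed distances to the
intersection point has Jacobian `[u_1,…,u_d]`. -/
theorem pi_intersectionTuples {a : ℝ≥0∞} (ha : a ≠ ∞) (hd : 1 ≤ d) (R : ℝ) {A : Set (Euc d)}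
    (hA : MeasurableSet A) :
    (Measure.pi fun _ : Fin d => (a • hyperplaneMeasure d).restrict (hittingBall d R))
      (intersectionTuples A) =
    (a * (ENNReal.ofReal (sphereArea d))⁻¹) ^ d * ∫⁻ x in A, normalIntegral d R x := by
  set k := a * (ENNReal.ofReal (sphereArea d))⁻¹ with hk
  have hktop : k ≠ ∞ := ENNReal.mul_ne_top ha
    (ENNReal.inv_ne_top.2 (by simpa using sphereArea_pos hd))
  set ν : Measure ℝ := k • (volume : Measure ℝ).restrict (Set.Icc (-R) R) with hν
  have : IsFiniteMeasure ν := by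
    rw [hν]
    exact Measure.smul_finite _ hktop
  simp_rw [smul_hyperplaneMeasure_restrict_hittingBall, ← hk, ← hν]
  have hof : Measurable fun p : Fin d → USphere d × ℝ => fun i => AffHyperplane.ofNormal (p i) :=
    measurable_pi_lambda _ fun i => AffHyperplane.measurable_ofNormal.comp (measurable_pi_apply i)
  rw [← Measure.pi_map_pi fun _ => AffHyperplane.measurable_ofNormal.aemeasurable,
    Measure.map_apply hof (measurableSet_intersectionTuples hA)]
  have hmp := measurePreserving_arrowProdEquivProdArrow (USphere d) ℝ (Fin d)
    (fun _ => sphereMeasure d) fun _ => ν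
  have hE := hof (measurableSet_intersectionTuples hA)
  rw [← hmp.symm.measure_preimage_equiv, Measure.prod_apply (hmp.symm.measurable hE)]
  have hinner : ∀ u : Fin d → USphere d, (Measure.pi fun _ : Fin d => ν) (Prod.mk u ⁻¹'
      ((MeasurableEquiv.arrowProdEquivProdArrow (USphere d) ℝ (Fin d)).symm ⁻¹'
        ((fun p : Fin d → USphere d × ℝ => fun i => AffHyperplane.ofNormal (p i)) ⁻¹'
          intersectionTuples A))) = k ^ d * ∫⁻ x in A,
      {u : Fin d → USphere d | ∀ i, |inner ℝ (u i : Euc d) x| ≤ R}.indicator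
        (fun u => ENNReal.ofReal (subspaceDet fun i => (u i : Euc d))) u := by
    intro u
    have hbox : MeasurableSet (Set.univ.pi fun _ : Fin d => Set.Icc (-R) R) :=
      MeasurableSet.univ_pi fun _ => measurableSet_Icc
    rw [hν, pi_smul_restrict_Icc k hktop, Measure.smul_apply, smul_eq_mul,
      Measure.restrict_apply' hbox]
    congr 1
    have hset : MeasurableSet {x : Euc d | ∀ i, |inner ℝ (u i : Euc d) x| ≤ R} := by
      simp only [Set.ofPred_forall]
      refine MeasurableSet.iInter fun i => (isClosed_le ?_ continuous_const).measurableSet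
      fun_prop
    have h2 : ∀ x : Euc d,
        {u : Fin d → USphere d | ∀ i, |inner ℝ (u i : Euc d) x| ≤ R}.indicator
        (fun u => ENNReal.ofReal (subspaceDet fun i => (u i : Euc d))) u =
        {x : Euc d | ∀ i, |inner ℝ (u i : Euc d) x| ≤ R}.indicator
          (fun _ => ENNReal.ofReal (subspaceDet fun i => (u i : Euc d))) x := fun x => rfl
    simp_rw [h2]
    rw [lintegral_indicator_const hset, Measure.restrict_apply hset, Set.inter_comm _ A,
      ← volume_setOf_cramerSolution_mem]
    congr 2
    ext s
    exact ofNormal_mem_intersectionTuples (p := fun i => (u i, s i))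
  simp_rw [hinner]
  rw [lintegral_const_mul', lintegral_lintegral_swap]
  · rfl
  · exact ((measurable_normalIntegrand R).comp measurable_swap).aemeasurable
  · exact ENNReal.pow_ne_top hktop

end density

end hyperplanes

/-! ### The density of the intersection process -/

section intensity

variable {d : ℕ}

theorem integrable_subspaceDet :
    Integrable (fun u : Fin d → USphere d => subspaceDet fun i => (u i : Euc d))
      (Measure.pi fun _ => sphereMeasure d) :=
  (continuous_subspaceDet fun i => by fun_prop).integrable_of_hasCompactSupport
    (HasCompactSupport.of_compactSpace _)

theorem subspaceDet_nonneg (u : Fin d → Euc d) : 0 ≤ subspaceDet u := ENNReal.toReal_nonneg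

theorem normalIntegral_le (R : ℝ) (x : Euc d) :
    normalIntegral d R x ≤ ENNReal.ofReal (∫ u : Fin d → USphere d,
      subspaceDet (fun i => (u i : Euc d)) ∂Measure.pi fun _ => sphereMeasure d) := by
  rw [ofReal_integral_eq_lintegral_ofReal integrable_subspaceDet
    (Eventually.of_forall fun _ => subspaceDet_nonneg _)]
  exact lintegral_mono fun u => Set.indicator_le_self _ _ _

theorem normalIntegral_ne_top (R : ℝ) (x : Euc d) : normalIntegral d R x ≠ ∞ :=
  ((normalIntegral_le R x).trans_lt ENNReal.ofReal_lt_top).ne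

theorem normalIntegral_of_norm_le {R : ℝ} {x : Euc d} (hx : ‖x‖ ≤ R) :
    normalIntegral d R x = ENNReal.ofReal (∫ u : Fin d → USphere d,
      subspaceDet (fun i => (u i : Euc d)) ∂Measure.pi fun _ => sphereMeasure d) := by
  rw [ofReal_integral_eq_lintegral_ofReal integrable_subspaceDet
    (Eventually.of_forall fun _ => subspaceDet_nonneg _)]
  refine lintegral_congr fun u => Set.indicator_of_mem ?_ _
  intro i
  refine (abs_real_inner_le_norm _ _).trans ?_
  rwa [norm_USphere, one_mul]

/-- The Lebesgue density of the intensity measure of the intersection process `Ξ_{t,R}`. -/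
noncomputable def intersectionDensity (d : ℕ) (t R : ℝ) (x : Euc d) : ℝ :=
  (t / sphereArea d) ^ d / (Nat.factorial d : ℝ) * (normalIntegral d R x).toReal

theorem measurable_intersectionDensity (t R : ℝ) : Measurable (intersectionDensity d t R) :=
  (measurable_normalIntegral R).ennreal_toReal.const_mul _

theorem intersectionDensity_nonneg {t : ℝ} (ht : 0 ≤ t) (R : ℝ) (x : Euc d) :
    0 ≤ intersectionDensity d t R x := by
  have : 0 ≤ sphereArea d := ENNReal.toReal_nonneg
  unfold intersectionDensity
  positivity

theorem intersectionDensity_of_norm_le (t : ℝ) {R : ℝ} {x : Euc d} (hx : ‖x‖ ≤ R) :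
    intersectionDensity d t R x = innerConst d / (Nat.factorial d : ℝ) * t ^ d := by
  rw [intersectionDensity, normalIntegral_of_norm_le hx, ENNReal.toReal_ofReal
    (integral_nonneg fun _ => subspaceDet_nonneg _), innerConst, div_pow]
  ring

/-- The intersection process is a random measure, and `intersectionDensity` is the density of its
intensity measure. -/
theorem intersectionProcess_intensity (hd : 1 ≤ d) {Ω : Type*} [MeasurableSpace Ω]
    {P : Measure Ω} [IsProbabilityMeasure P] {t : ℝ} (ht : 0 < t)
    {η : Ω → Set (AffHyperplane d)} (h : IsPoissonHyperplaneProcess P t η) (R : ℝ) :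
    AEMeasurable (intersectionProcess η R) P ∧
      intensityMeasure P (intersectionProcess η R) =
        volume.withDensity fun x => ENNReal.ofReal (intersectionDensity d t R x) := by
  obtain ⟨e, he, hofe⟩ := AffHyperplane.exists_measurable_section (d := d)
  have hω := sphereArea_pos hd
  have hk : ENNReal.ofReal t * (ENNReal.ofReal (sphereArea d))⁻¹ ≠ ∞ :=
    ENNReal.mul_ne_top ENNReal.ofReal_ne_top (ENNReal.inv_ne_top.2 (by simpa using hω))
  have hW := AffHyperplane.measurableSet_hittingBall (d := d) R
  have hfin : (ENNReal.ofReal t • hyperplaneMeasure d) (hittingBall d R) ≠ ∞ := by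
    have : IsFiniteMeasure ((ENNReal.ofReal t * (ENNReal.ofReal (sphereArea d))⁻¹) •
      (volume : Measure ℝ).restrict (Set.Icc (-R) R)) := Measure.smul_finite _ hk
    rw [← Measure.restrict_apply_univ, smul_hyperplaneMeasure_restrict_hittingBall]
    exact measure_ne_top _ _
  obtain ⟨hN, hbind⟩ := IsPoissonProcess.bind_tupleMeasure he
    (Function.LeftInverse.injective hofe) h d hW hfin
  obtain ⟨Ψ, hΨ, hΨS⟩ := exists_measurable_intersectionPoints (d := d)
  have hae : AEMeasurable (intersectionProcess η R) P := by
    refine (hΨ.comp_aemeasurable hN).congr (Eventually.of_forall fun ω => ?_)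
    exact (hΨS _).symm
  refine ⟨hae, Measure.ext fun A hA => ?_⟩
  have hTm := measurableSet_intersectionTuples hA
  rw [intensityMeasure, Measure.bind_apply hA hae]
  simp_rw [intersectionProcess, intersectionPoints_apply _ hA]
  have hsub : intersectionTuples A ⊆ {p | Function.Injective p} :=
    fun H hH => injective_of_mem_intersectionTuples hH
  rw [lintegral_const_mul' _ _ (by simp [Nat.factorial_ne_zero]), ← Measure.bind_apply hTm hN,
    hbind, Measure.restrict_apply hTm, Set.inter_eq_left.2 hsub,
    pi_intersectionTuples ENNReal.ofReal_ne_top hd R hA,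
    withDensity_apply _ hA, ← mul_assoc, ← lintegral_const_mul _ (measurable_normalIntegral R)]
  refine lintegral_congr fun x => ?_
  rw [intersectionDensity, ENNReal.ofReal_mul (by positivity),
    ENNReal.ofReal_toReal (normalIntegral_ne_top R x), ENNReal.ofReal_div_of_pos (by positivity),
    ENNReal.ofReal_pow (by positivity), ENNReal.ofReal_div_of_pos hω, ENNReal.ofReal_natCast,
    div_eq_mul_inv, div_eq_mul_inv, mul_comm (_ ^ d)]

end intensity

/-! ### Cylindrical coordinates on the sphere -/

theorem pi_measure_mono {ι : Type*} [Fintype ι] {α : ι → Type*} [∀ i, MeasurableSpace (α i)]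
    {μ ν : ∀ i, Measure (α i)} (h : ∀ i, μ i ≤ ν i) : Measure.pi μ ≤ Measure.pi ν := by
  refine Measure.le_iff.2 fun s hs => ?_
  rw [Measure.pi, Measure.pi, toMeasure_apply _ _ hs, toMeasure_apply _ _ hs]
  have : OuterMeasure.pi (fun i => (μ i).toOuterMeasure) ≤
      OuterMeasure.pi fun i => (ν i).toOuterMeasure := by
    rw [OuterMeasure.le_pi]
    intro s _
    exact (OuterMeasure.pi_pi_le _ _).trans (Finset.prod_le_prod' fun i _ => h i (s i))
  exact this s

/-- Integration in polar coordinates. -/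
theorem lintegral_eq_lintegral_sphere {n : ℕ} (hn : 1 ≤ n) {F : Euc n → ℝ≥0∞}
    (hF : Measurable F) :
    ∫⁻ y, F y = ∫⁻ v : USphere n, ∫⁻ r : Set.Ioi (0 : ℝ), F ((r : ℝ) • (v : Euc n))
      ∂Measure.volumeIoiPow (n - 1) ∂sphereMeasure n := by
  have : Nonempty (Fin n) := ⟨⟨0, hn⟩⟩
  have hmp := (volume : Measure (Euc n)).measurePreserving_homeomorphUnitSphereProd
  rw [finrank_euclideanSpace_fin] at hmp
  have hF2 : Measurable fun p : USphere n × Set.Ioi (0 : ℝ) => F ((p.2 : ℝ) • (p.1 : Euc n)) :=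
    hF.comp (by fun_prop)
  rw [sphereMeasure, ← lintegral_prod _ hF2.aemeasurable,
    ← hmp.lintegral_comp_emb (Homeomorph.measurableEmbedding _)]
  have h1 : ∀ x : ({0}ᶜ : Set (Euc n)), F (((homeomorphUnitSphereProd (Euc n) x).2 : ℝ) •
      ((homeomorphUnitSphereProd (Euc n) x).1 : Euc n)) = F x := by
    intro x
    congr 1
    exact congrArg Subtype.val ((homeomorphUnitSphereProd (Euc n)).symm_apply_apply x)
  simp_rw [h1]
  rw [lintegral_subtype_comap (measurableSet_singleton _).compl F,
    restrict_compl_singleton]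

theorem volumeIoiPow_lintegral_indicator (n : ℕ) {a : ℝ} (ha : 0 < a) :
    ∫⁻ r : Set.Ioi (0 : ℝ), (Set.Iio a).indicator (1 : ℝ → ℝ≥0∞) r ∂Measure.volumeIoiPow n =
      ENNReal.ofReal (a ^ (n + 1)) * (ENNReal.ofReal (n + 1))⁻¹ := by
  have h : ∀ r : Set.Ioi (0 : ℝ), (Set.Iio a).indicator (1 : ℝ → ℝ≥0∞) r =
      (Set.Iio (⟨a, ha⟩ : Set.Ioi (0 : ℝ))).indicator 1 r := fun r => rfl
  simp_rw [h]
  rw [lintegral_indicator_one measurableSet_Iio, Measure.volumeIoiPow_apply_Iio,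
    ENNReal.ofReal_div_of_pos (by positivity), div_eq_mul_inv]

theorem measurePreserving_addLast (m : ℕ) :
    MeasurePreserving (fun p : Euc m × ℝ => (addLast p.1 p.2 : Euc (m + 1))) := by
  have h1 := (volume_preserving_piFinSuccAbove (fun _ : Fin (m + 1) => ℝ) (Fin.last m)).symm
  have h2 := PiLp.volume_preserving_toLp (Fin (m + 1))
  have h3 := (PiLp.volume_preserving_ofLp (Fin m)).prod (MeasurePreserving.id (volume : Measure ℝ))
  have h4 := (h2.comp (h1.comp (Measure.measurePreserving_swap.comp h3)))
  have h5 : (fun p : Euc m × ℝ => (addLast p.1 p.2 : Euc (m + 1))) =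
      WithLp.toLp 2 ∘ (MeasurableEquiv.piFinSuccAbove (fun _ => ℝ) (Fin.last m)).symm ∘ Prod.swap ∘
        Prod.map WithLp.ofLp id := by
    ext p i
    simp only [addLast, Function.comp, MeasurableEquiv.piFinSuccAbove]
    simp [Fin.insertNthEquiv, Fin.snoc, Fin.castLT]
  rw [h5]
  exact h4

theorem norm_addLast_sq {m : ℕ} (v : Euc m) (z : ℝ) :
    ‖(addLast v z : Euc (m + 1))‖ ^ 2 = ‖v‖ ^ 2 + z ^ 2 := by
  rw [EuclideanSpace.norm_sq_eq, EuclideanSpace.norm_sq_eq, Fin.sum_univ_castSucc]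
  simp [addLast]

theorem norm_addLast_USphere {m : ℕ} (v : USphere m) (z : ℝ) :
    ‖addLast (d := m + 1) (v : Euc m) z‖ = √(1 + z ^ 2) := by
  rw [← Real.sqrt_sq (norm_nonneg (addLast (d := m + 1) (v : Euc m) z)), norm_addLast_sq,
    norm_USphere, one_pow]

theorem smul_addLast {m : ℕ} (r : ℝ) (v : Euc m) (z : ℝ) :
    (addLast (r • v) (r * z) : Euc (m + 1)) = r • addLast (d := m + 1) v z := by
  ext i
  simp only [addLast, PiLp.smul_apply, smul_eq_mul]
  split_ifs <;> rfl

theorem continuous_addLast {m : ℕ} :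
    Continuous fun p : Euc m × ℝ => (addLast p.1 p.2 : Euc (m + 1)) := by
  refine (PiLp.continuous_toLp 2 _).comp (continuous_pi fun i => ?_)
  by_cases h : (i : ℕ) < m + 1 - 1
  · simp only [h, dif_pos]
    exact (EuclideanSpace.proj (𝕜 := ℝ) _).continuous.comp continuous_fst
  · simp only [h, dif_neg, not_false_iff]
    exact continuous_snd

/-- The point of `S^m` on the ray through `v + z e_{m+1}`. -/
noncomputable def sphereLift {m : ℕ} (p : USphere m × ℝ) : USphere (m + 1) :=
  ⟨(√(1 + p.2 ^ 2))⁻¹ • addLast (d := m + 1) (p.1 : Euc m) p.2, by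
    have : 0 < √(1 + p.2 ^ 2) := Real.sqrt_pos.2 (by positivity)
    rw [mem_sphere_zero_iff_norm, norm_smul, norm_addLast_USphere, norm_inv, Real.norm_eq_abs,
      abs_of_pos this, inv_mul_cancel₀ this.ne']⟩

theorem continuous_sphereLift {m : ℕ} : Continuous (sphereLift (m := m)) := by
  have h1 : Continuous fun p : USphere m × ℝ => (√(1 + p.2 ^ 2))⁻¹ :=
    Continuous.inv₀ (by fun_prop) fun p => (Real.sqrt_pos.2 (by positivity)).ne'
  have h2 : Continuous fun p : USphere m × ℝ => addLast (d := m + 1) (p.1 : Euc m) p.2 :=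
    continuous_addLast.comp (by fun_prop : Continuous fun p : USphere m × ℝ => ((p.1 : Euc m), p.2))
  exact Continuous.subtype_mk (h1.smul h2) _

/-- The density of the spherical Lebesgue measure in the coordinates `sphereLift`. -/
noncomputable def liftWeight (m : ℕ) (z : ℝ) : ℝ≥0∞ :=
  ENNReal.ofReal ((√(1 + z ^ 2))⁻¹ ^ (m + 1))

theorem measurable_liftWeight (m : ℕ) : Measurable (liftWeight m) := by
  unfold liftWeight
  fun_prop

theorem lintegral_mul_left_real {r : ℝ} (hr : 0 < r) {F : ℝ → ℝ≥0∞} (hF : Measurable F) :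
    ∫⁻ z, F z = ENNReal.ofReal r * ∫⁻ z, F (r * z) := by
  conv_lhs => rw [← Real.smul_map_volume_mul_left hr.ne']
  rw [lintegral_smul_measure, lintegral_map hF (measurable_const_mul r), abs_of_pos hr, smul_eq_mul]

/-- Cylindrical coordinates on the sphere: a comparison of Lebesgue measure in polar coordinates of
`ℝ^{m+1}` and of `ℝ^m`. -/
theorem lintegral_sphere_succ {m : ℕ} (hm : 1 ≤ m) {G : USphere (m + 1) → ℝ≥0∞}
    (hG : Measurable G) :
    ∫⁻ u, G u ∂sphereMeasure (m + 1) =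
      ∫⁻ v, ∫⁻ z, liftWeight m z * G (sphereLift (v, z)) ∂volume ∂sphereMeasure m := by
  classical
  -- Both sides times `w = ∫₀¹ r^m dr` are the integral of `F`, the degree `0` homogeneous extension
  -- of `G` cut off at the unit ball: on the left in polar coordinates of `ℝ^{m+1}`, on the right in
  -- polar coordinates of `ℝ^m` with the last coordinate rescaled by the radius.
  let w : ℝ≥0∞ := (ENNReal.ofReal (m + 1))⁻¹
  have hw0 : w ≠ 0 := ENNReal.inv_ne_zero.2 ENNReal.ofReal_ne_top
  have hwt : w ≠ ∞ := ENNReal.inv_ne_top.2 (by positivity)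
  let u₀ : USphere (m + 1) := ⟨EuclideanSpace.single 0 1, by simp⟩
  -- the radial projection to the sphere
  let π : Euc (m + 1) → USphere (m + 1) := fun y =>
    if h : y = 0 then u₀ else ⟨‖y‖⁻¹ • y, by
      rw [mem_sphere_zero_iff_norm, norm_smul, norm_inv, norm_norm,
        inv_mul_cancel₀ (norm_ne_zero_iff.2 h)]⟩
  have hπ : Measurable π := by
    have h1 : Measurable fun y => (π y : Euc (m + 1)) := by
      have : (fun y => (π y : Euc (m + 1))) = fun y => if y = 0 then (u₀ : Euc (m + 1)) else
          ‖y‖⁻¹ • y := by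
        ext1 y
        by_cases h : y = 0 <;> simp [π, h]
      rw [this]
      exact Measurable.ite (measurableSet_singleton 0) measurable_const (by fun_prop)
    exact h1.subtype_mk (h := fun y => (π y).2)
  have hπv : ∀ (v : USphere (m + 1)) (r : ℝ), 0 < r → π (r • (v : Euc (m + 1))) = v := by
    intro v r hr
    have hne : r • (v : Euc (m + 1)) ≠ 0 := by
      rw [← norm_ne_zero_iff, norm_smul, norm_USphere]
      simpa using hr.ne'
    refine Subtype.ext ?_
    simp only [π, hne, dif_neg, not_false_iff]
    rw [norm_smul, norm_USphere, mul_one, Real.norm_eq_abs, abs_of_pos hr, inv_smul_smul₀ hr.ne']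
  let F : Euc (m + 1) → ℝ≥0∞ := fun y => G (π y) * (Set.Iio (1 : ℝ)).indicator 1 ‖y‖
  have hF : Measurable F := by
    have h1 : Measurable ((Set.Iio (1 : ℝ)).indicator (1 : ℝ → ℝ≥0∞)) :=
      measurable_one.indicator measurableSet_Iio
    exact (hG.comp hπ).mul (h1.comp measurable_norm)
  have hind : ∀ a : ℝ, Measurable fun r : Set.Ioi (0 : ℝ) =>
      (Set.Iio a).indicator (1 : ℝ → ℝ≥0∞) r := fun a =>
    ((measurable_one (α := ℝ≥0∞)).indicator measurableSet_Iio).comp measurable_subtype_coe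
  have hL : ∫⁻ y, F y = w * ∫⁻ u, G u ∂sphereMeasure (m + 1) := by
    rw [lintegral_eq_lintegral_sphere (by omega) hF, ← lintegral_const_mul _ hG]
    refine lintegral_congr fun v => ?_
    have : ∀ r : Set.Ioi (0 : ℝ), F ((r : ℝ) • (v : Euc (m + 1))) =
        G v * (Set.Iio (1 : ℝ)).indicator 1 (r : ℝ) := by
      intro r
      have hr : 0 < (r : ℝ) := r.2
      simp only [F]
      rw [hπv v r hr, norm_smul, norm_USphere, mul_one, Real.norm_eq_abs, abs_of_pos hr]
    simp_rw [this]
    rw [lintegral_const_mul _ (hind _), volumeIoiPow_lintegral_indicator _ one_pos]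
    simp [w, mul_comm]
  have hadd : Measurable fun p : Euc m × ℝ => (addLast p.1 p.2 : Euc (m + 1)) :=
    continuous_addLast.measurable
  have hR : ∫⁻ y, F y =
      w * ∫⁻ v, ∫⁻ z, liftWeight m z * G (sphereLift (v, z)) ∂volume ∂sphereMeasure m := by
    have hmeas1 : Measurable fun y : Euc m => ∫⁻ z, F (addLast y z) :=
      (hF.comp hadd).lintegral_prod_right'
    have hmeas2 : Measurable fun q : (USphere m × ℝ) =>
        liftWeight m q.2 * G (sphereLift q) :=
      ((measurable_liftWeight m).comp measurable_snd).mul (hG.comp continuous_sphereLift.measurable)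
    rw [← (measurePreserving_addLast m).lintegral_comp hF]
    rw [Measure.volume_eq_prod, lintegral_prod (fun p : Euc m × ℝ => F (addLast p.1 p.2))
      (hF.comp hadd).aemeasurable,
      lintegral_eq_lintegral_sphere hm hmeas1, ← lintegral_const_mul _ hmeas2.lintegral_prod_right']
    refine lintegral_congr fun v => ?_
    have h1 : ∀ r : Set.Ioi (0 : ℝ), ∫⁻ z, F (addLast ((r : ℝ) • (v : Euc m)) z) =
        ENNReal.ofReal r * ∫⁻ z, G (sphereLift (v, z)) *
          (Set.Iio (√(1 + z ^ 2))⁻¹).indicator 1 (r : ℝ) := by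
      intro r
      have hr : 0 < (r : ℝ) := r.2
      have hFr : Measurable fun z => F (addLast ((r : ℝ) • (v : Euc m)) z) :=
        hF.comp (hadd.comp measurable_prodMk_left)
      refine (lintegral_mul_left_real hr hFr).trans ?_
      congr 1
      refine lintegral_congr fun z => ?_
      have hs : 0 < √(1 + z ^ 2) := Real.sqrt_pos.2 (by positivity)
      have h2 : (addLast ((r : ℝ) • (v : Euc m)) (r * z) : Euc (m + 1)) =
          ((r : ℝ) * √(1 + z ^ 2)) • (sphereLift (v, z) : Euc (m + 1)) := by
        rw [smul_addLast, sphereLift, smul_smul, mul_assoc, mul_inv_cancel₀ hs.ne', mul_one]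
      simp only [F]
      rw [h2, hπv _ _ (by positivity), norm_smul, norm_USphere, mul_one, Real.norm_eq_abs,
        abs_of_pos (by positivity)]
      congr 1
      simp only [Set.indicator_apply, Set.mem_Iio, ← one_div, lt_div_iff₀ hs, Pi.one_apply]
    simp_rw [h1]
    have hmeas3 : Measurable fun q : Set.Ioi (0 : ℝ) × ℝ => G (sphereLift (v, q.2)) *
        (Set.Iio (√(1 + q.2 ^ 2))⁻¹).indicator (1 : ℝ → ℝ≥0∞) (q.1 : ℝ) := by
      refine Measurable.mul ?_ ?_
      · exact hG.comp (continuous_sphereLift.measurable.comp (by fun_prop))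
      · have : MeasurableSet {q : Set.Ioi (0 : ℝ) × ℝ | (q.1 : ℝ) < (√(1 + q.2 ^ 2))⁻¹} :=
          measurableSet_lt (by fun_prop) (by fun_prop)
        exact (measurable_one (α := ℝ≥0∞)).indicator this
    have h3 : ∀ K : Set.Ioi (0 : ℝ) → ℝ≥0∞, Measurable K →
        ∫⁻ r, ENNReal.ofReal (r : ℝ) * K r ∂Measure.volumeIoiPow (m - 1) =
          ∫⁻ r, K r ∂Measure.volumeIoiPow m := by
      intro K hK
      rw [Measure.volumeIoiPow, Measure.volumeIoiPow, lintegral_withDensity_eq_lintegral_mul _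
        (by fun_prop) (by fun_prop), lintegral_withDensity_eq_lintegral_mul _ (by fun_prop) hK]
      refine lintegral_congr fun r => ?_
      have hr : 0 < (r : ℝ) := r.2
      simp only [Pi.mul_apply]
      rw [← mul_assoc, ← ENNReal.ofReal_mul (by positivity), ← pow_succ, Nat.sub_add_cancel hm]
    have hmeas4 : Measurable fun z => liftWeight m z * G (sphereLift (v, z)) :=
      (measurable_liftWeight m).mul
        (hG.comp (continuous_sphereLift.measurable.comp measurable_prodMk_left))
    let H : Set.Ioi (0 : ℝ) → ℝ → ℝ≥0∞ := fun r z => G (sphereLift (v, z)) *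
      (Set.Iio (√(1 + z ^ 2))⁻¹).indicator (1 : ℝ → ℝ≥0∞) (r : ℝ)
    have hH : Measurable fun r => ∫⁻ z, H r z := hmeas3.lintegral_prod_right'
    have hswap : ∫⁻ r, ∫⁻ z, H r z ∂volume ∂Measure.volumeIoiPow m =
        ∫⁻ z, ∫⁻ r, H r z ∂Measure.volumeIoiPow m :=
      lintegral_lintegral_swap hmeas3.aemeasurable
    refine (h3 (fun r => ∫⁻ z, H r z) hH).trans (hswap.trans ?_)
    rw [← lintegral_const_mul _ hmeas4]
    refine lintegral_congr fun z => ?_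
    have hs : 0 < √(1 + z ^ 2) := Real.sqrt_pos.2 (by positivity)
    rw [lintegral_const_mul _ (hind _), volumeIoiPow_lintegral_indicator _ (inv_pos.2 hs)]
    simp only [liftWeight, w]
    ring
  exact (ENNReal.mul_right_inj hw0 hwt).1 (hL.symm.trans hR)

/-! ### Rotation invariance -/

section rotation

open scoped Pointwise

variable {d : ℕ}

/-- The action of a linear isometry on the unit sphere. -/
noncomputable def sphereRotate (L : Euc d ≃ₗᵢ[ℝ] Euc d) (u : USphere d) : USphere d :=
  ⟨L u, by rw [mem_sphere_zero_iff_norm, L.norm_map, norm_USphere]⟩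

theorem continuous_sphereRotate (L : Euc d ≃ₗᵢ[ℝ] Euc d) : Continuous (sphereRotate L) :=
  Continuous.subtype_mk (L.continuous.comp continuous_subtype_val) _

theorem measurePreserving_sphereRotate (L : Euc d ≃ₗᵢ[ℝ] Euc d) :
    MeasurePreserving (sphereRotate L) (sphereMeasure d) (sphereMeasure d) := by
  have hm := (continuous_sphereRotate L).measurable
  refine ⟨hm, Measure.ext fun s hs => ?_⟩
  rw [Measure.map_apply hm hs, sphereMeasure, Measure.toSphere_apply' _ hs,
    Measure.toSphere_apply' _ (hm hs)]
  congr 1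
  have : (Set.Ioo (0 : ℝ) 1 • (Subtype.val '' (sphereRotate L ⁻¹' s)) : Set (Euc d)) =
      L ⁻¹' (Set.Ioo (0 : ℝ) 1 • (Subtype.val '' s)) := by
    ext x
    simp only [Set.mem_smul, Set.mem_preimage, Set.mem_image]
    constructor
    · rintro ⟨r, hr, _, ⟨u, hu, rfl⟩, rfl⟩
      exact ⟨r, hr, _, ⟨sphereRotate L u, hu, rfl⟩, by rw [map_smul]; rfl⟩
    · rintro ⟨r, hr, _, ⟨u, hu, rfl⟩, hx⟩
      refine ⟨r, hr, _, ⟨sphereRotate L.symm u, ?_, rfl⟩, ?_⟩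
      · have : sphereRotate L (sphereRotate L.symm u) = u :=
          Subtype.ext (L.apply_symm_apply (u : Euc d))
        rwa [this]
      · have : r • L.symm (u : Euc d) = x := by rw [← map_smul, hx, L.symm_apply_apply]
        exact this
  rw [this]
  exact L.measurePreserving.measure_preimage_emb L.toHomeomorph.measurableEmbedding _

theorem subspaceDet_map (L : Euc d ≃ₗᵢ[ℝ] Euc d) (u : Fin d → Euc d) :
    subspaceDet (fun i => L (u i)) = subspaceDet u := by
  have h1 := image_parallelepiped (L.toLinearEquiv : Euc d →ₗ[ℝ] Euc d) u
  have h2 : parallelepiped (fun i => L (u i)) = L.symm ⁻¹' parallelepiped u := by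
    have : parallelepiped (fun i => L (u i)) = L '' parallelepiped u := h1.symm
    rw [this]
    exact L.toEquiv.image_eq_preimage_symm _
  rw [subspaceDet, subspaceDet, measureReal_def, measureReal_def, h2]
  congr 1
  exact L.symm.measurePreserving.measure_preimage_emb L.symm.toHomeomorph.measurableEmbedding _

theorem measurable_normalIntegrand_right (R : ℝ) (x : Euc d) :
    Measurable fun u : Fin d → USphere d =>
      {u : Fin d → USphere d | ∀ i, |inner ℝ (u i : Euc d) x| ≤ R}.indicator
        (fun u => ENNReal.ofReal (subspaceDet fun i => (u i : Euc d))) u := by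
  refine (continuous_subspaceDet fun i => by fun_prop).measurable.ennreal_ofReal.indicator ?_
  simp only [Set.ofPred_forall]
  refine MeasurableSet.iInter fun i => (isClosed_le ?_ continuous_const).measurableSet
  fun_prop

theorem normalIntegral_map (L : Euc d ≃ₗᵢ[ℝ] Euc d) (R : ℝ) (x : Euc d) :
    normalIntegral d R (L x) = normalIntegral d R x := by
  have hmp := measurePreserving_pi (fun _ : Fin d => sphereMeasure d) (fun _ => sphereMeasure d)
    fun _ => measurePreserving_sphereRotate L
  rw [normalIntegral, ← hmp.lintegral_comp (measurable_normalIntegrand_right R (L x)),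
    normalIntegral]
  refine lintegral_congr fun u => ?_
  have h1 : ∀ i, inner ℝ (sphereRotate L (u i) : Euc d) (L x) = inner ℝ (u i : Euc d) x :=
    fun i => L.inner_map_map _ _
  have h2 := subspaceDet_map L fun i => (u i : Euc d)
  simp only [Set.indicator_apply, Set.mem_ofPred_eq, h1]
  congr 2

theorem normalIntegral_congr_norm (R : ℝ) {x y : Euc d} (h : ‖x‖ = ‖y‖) :
    normalIntegral d R x = normalIntegral d R y := by
  rw [← normalIntegral_map ((ℝ ∙ (x - y))ᗮ.reflection) R x, Submodule.reflection_sub h]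

end rotation

/-! ### The density far from the origin -/

section outer

variable {m : ℕ}

/-- `lintegral_sphere_succ` as an identity of measures. -/
theorem map_sphereLift (hm : 1 ≤ m) :
    ((sphereMeasure m).prod ((volume : Measure ℝ).withDensity (liftWeight m))).map sphereLift =
      sphereMeasure (m + 1) := by
  have hl : Measurable (sphereLift (m := m)) := continuous_sphereLift.measurable
  have hw : Measurable fun p : USphere m × ℝ => liftWeight m p.2 :=
    (measurable_liftWeight m).comp measurable_snd
  refine Measure.ext fun s hs => ?_
  rw [Measure.map_apply hl hs, prod_withDensity_right (measurable_liftWeight m),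
    withDensity_apply _ (hl hs), ← lintegral_indicator_one hs,
    lintegral_sphere_succ hm (measurable_one.indicator hs), ← lintegral_indicator (hl hs),
    lintegral_prod _ (hw.indicator (hl hs)).aemeasurable]
  refine lintegral_congr fun v => lintegral_congr fun z => ?_
  by_cases h : sphereLift (v, z) ∈ s <;> simp [h]

/-- The part `|z| ≤ k` of the cylinder `S^{m-1} × ℝ`. -/
noncomputable def cylinderMeasure (m : ℕ) (k : ℝ) : Measure (USphere m × ℝ) :=
  (sphereMeasure m).prod ((volume : Measure ℝ).restrict (Set.Icc (-k) k))

instance (m : ℕ) (k : ℝ) : IsFiniteMeasure (cylinderMeasure m k) := by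
  unfold cylinderMeasure
  infer_instance

theorem prod_withDensity_restrict (m : ℕ) (k : ℝ) :
    ((sphereMeasure m).prod ((volume : Measure ℝ).withDensity (liftWeight m))).restrict
      (Set.univ ×ˢ Set.Icc (-k) k) =
    (cylinderMeasure m k).withDensity fun p => liftWeight m p.2 := by
  rw [prod_withDensity_right (measurable_liftWeight m), restrict_withDensity
    (MeasurableSet.univ.prod measurableSet_Icc), ← Measure.prod_restrict, Measure.restrict_univ,
    cylinderMeasure]

theorem liftWeight_le_one (m : ℕ) (z : ℝ) : liftWeight m z ≤ 1 := by
  rw [liftWeight, ENNReal.ofReal_le_one]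
  refine pow_le_one₀ (by positivity) (inv_le_one_of_one_le₀ ?_)
  rw [Real.one_le_sqrt]
  nlinarith [sq_nonneg z]

theorem inv_sqrt_le_inv_sqrt {k z : ℝ} (hz : |z| ≤ k) :
    (√(1 + k ^ 2))⁻¹ ≤ (√(1 + z ^ 2))⁻¹ := by
  refine inv_anti₀ (Real.sqrt_pos.2 (by positivity)) (Real.sqrt_le_sqrt ?_)
  have := sq_le_sq' (by linarith [neg_abs_le z, abs_nonneg z]) ((le_abs_self z).trans hz)
  linarith

theorem liftWeight_le_of_abs_le (m : ℕ) {k z : ℝ} (hz : |z| ≤ k) :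
    liftWeight m k ≤ liftWeight m z :=
  ENNReal.ofReal_le_ofReal (pow_le_pow_left₀ (by positivity) (inv_sqrt_le_inv_sqrt hz) _)

theorem withDensity_liftWeight_le (m : ℕ) (k : ℝ) :
    ((cylinderMeasure m k).withDensity fun p => liftWeight m p.2) ≤ cylinderMeasure m k := by
  conv_rhs => rw [← withDensity_one (μ := cylinderMeasure m k)]
  exact withDensity_mono (Eventually.of_forall fun p => liftWeight_le_one m p.2)

theorem ae_cylinderMeasure (m : ℕ) (k : ℝ) : ∀ᵐ p ∂cylinderMeasure m k, |p.2| ≤ k := by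
  have : cylinderMeasure m k = ((sphereMeasure m).prod volume).restrict
      (Set.univ ×ˢ Set.Icc (-k) k) := by
    rw [← Measure.prod_restrict, Measure.restrict_univ, cylinderMeasure]
  rw [this]
  filter_upwards [ae_restrict_mem (MeasurableSet.univ.prod measurableSet_Icc)] with p hp
  exact abs_le.2 hp.2

theorem le_withDensity_liftWeight (m : ℕ) (k : ℝ) :
    liftWeight m k • cylinderMeasure m k ≤
      (cylinderMeasure m k).withDensity fun p => liftWeight m p.2 := by
  rw [← withDensity_const]
  refine withDensity_mono ?_
  filter_upwards [ae_cylinderMeasure m k] with p hp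
  exact liftWeight_le_of_abs_le m hp

theorem pi_smul_measure {ι X : Type*} [Fintype ι] [MeasurableSpace X] (μ : Measure X)
    [IsFiniteMeasure μ] {c : ℝ≥0∞} (hc : c ≠ ∞) :
    (Measure.pi fun _ : ι => c • μ) = c ^ Fintype.card ι • Measure.pi fun _ : ι => μ := by
  have : IsFiniteMeasure (c • μ) := Measure.smul_finite _ hc
  refine Measure.pi_eq fun s hs => ?_
  rw [Measure.smul_apply, Measure.pi_pi]
  simp [Finset.prod_mul_distrib]

theorem subspaceDet_smul {d : ℕ} (c : Fin d → ℝ) (u : Fin d → Euc d) :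
    subspaceDet (fun i => c i • u i) = |∏ i, c i| * subspaceDet u := by
  rw [subspaceDet_eq_abs_det, subspaceDet_eq_abs_det, ← abs_mul, ← Matrix.det_mul_column]
  rfl

theorem subspaceDet_addLast_mul (k : ℝ) (v : Fin (m + 1) → Euc m) (z : Fin (m + 1) → ℝ) :
    subspaceDet (fun i => (addLast (v i) (k * z i) : Euc (m + 1))) =
      |k| * subspaceDet fun i => (addLast (v i) (z i) : Euc (m + 1)) := by
  rw [subspaceDet_eq_abs_det, subspaceDet_eq_abs_det, ← abs_mul]
  congr 1
  have := Matrix.det_mul_row (fun j : Fin (m + 1) => if (j : ℕ) < m then 1 else k)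
    (rowMatrix fun i => (addLast (v i) (z i) : Euc (m + 1)))
  rw [Fin.prod_univ_castSucc] at this
  simp only [Fin.val_castSucc, Fin.is_lt, if_true, Finset.prod_const_one, Fin.val_last,
    lt_irrefl, if_false, one_mul] at this
  rw [← this]
  congr 1
  ext i j
  by_cases h : (j : ℕ) < m <;> simp [rowMatrix, addLast, h]

/-- The integral of `[v_1 + z_1 e_d,…,v_d + z_d e_d]` over unit vectors `v_i` orthogonal to `e_d`
and `|z_i| ≤ k`. -/
noncomputable def cylinderIntegral (m : ℕ) (k : ℝ) : ℝ≥0∞ :=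
  ∫⁻ p : Fin (m + 1) → USphere m × ℝ,
    ENNReal.ofReal (subspaceDet fun i => (addLast ((p i).1 : Euc m) (p i).2 : Euc (m + 1)))
      ∂Measure.pi fun _ => cylinderMeasure m k

theorem continuous_subspaceDet_addLast :
    Continuous fun p : Fin (m + 1) → USphere m × ℝ =>
      subspaceDet fun i => (addLast ((p i).1 : Euc m) (p i).2 : Euc (m + 1)) := by
  refine continuous_subspaceDet fun i => ?_
  exact continuous_addLast.comp (by fun_prop :
    Continuous fun p : Fin (m + 1) → USphere m × ℝ => (((p i).1 : Euc m), (p i).2))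

theorem cylinderIntegral_eq {k : ℝ} (hk : 0 < k) :
    cylinderIntegral m k = ENNReal.ofReal (k ^ (m + 2)) * cylinderIntegral m 1 := by
  have hmul : Measurable fun z : ℝ => k * z := measurable_const_mul k
  have h1 : (volume : Measure ℝ).restrict (Set.Icc (-k) k) =
      ENNReal.ofReal k • ((volume : Measure ℝ).restrict (Set.Icc (-1) 1)).map (k * ·) := by
    conv_lhs => rw [← Real.smul_map_volume_mul_left hk.ne', abs_of_pos hk]
    rw [Measure.restrict_smul, Measure.restrict_map hmul measurableSet_Icc]
    congr 4
    ext z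
    simp only [Set.mem_preimage, Set.mem_Icc]
    constructor <;> rintro ⟨h1, h2⟩ <;> constructor <;> nlinarith
  have h2 : cylinderMeasure m k =
      ENNReal.ofReal k • (cylinderMeasure m 1).map (Prod.map id (k * ·)) := by
    rw [cylinderMeasure, h1, Measure.prod_smul_right, cylinderMeasure,
      ← Measure.map_prod_map _ _ measurable_id hmul, Measure.map_id]
  have hpm : Measurable (Prod.map id (k * ·) : USphere m × ℝ → USphere m × ℝ) :=
    measurable_id.prodMap hmul
  have hpi : Measurable fun (p : Fin (m + 1) → USphere m × ℝ) (i : Fin (m + 1)) =>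
      Prod.map id (k * ·) (p i) :=
    measurable_pi_lambda _ fun i => hpm.comp (measurable_pi_apply i)
  have : IsFiniteMeasure ((cylinderMeasure m 1).map
    (Prod.map id (k * ·) : USphere m × ℝ → USphere m × ℝ)) := Measure.isFiniteMeasure_map _ _
  rw [cylinderIntegral, h2, pi_smul_measure _ ENNReal.ofReal_ne_top, lintegral_smul_measure,
    ← Measure.pi_map_pi fun _ => hpm.aemeasurable, lintegral_map
      continuous_subspaceDet_addLast.measurable.ennreal_ofReal hpi, cylinderIntegral]
  have h3 : ∀ p : Fin (m + 1) → USphere m × ℝ, ENNReal.ofReal (subspaceDet fun i =>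
      (addLast ((Prod.map id (k * ·) (p i)).1 : Euc m) (Prod.map id (k * ·) (p i)).2 : Euc (m + 1)))
      = ENNReal.ofReal k * ENNReal.ofReal (subspaceDet fun i =>
        (addLast ((p i).1 : Euc m) (p i).2 : Euc (m + 1))) := by
    intro p
    rw [← ENNReal.ofReal_mul hk.le, ← abs_of_pos hk, ← subspaceDet_addLast_mul, abs_of_pos hk]
    rfl
  simp_rw [h3]
  rw [lintegral_const_mul _ continuous_subspaceDet_addLast.measurable.ennreal_ofReal, smul_eq_mul,
    ← mul_assoc, Fintype.card_fin, ← ENNReal.ofReal_pow hk.le, ← ENNReal.ofReal_mul (by positivity),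
    ← pow_succ]

/-- The double integral in the definition of `outerConst`. -/
noncomputable def outerIntegral (m : ℕ) : ℝ :=
  ∫ z in Set.Icc (-1 : Fin (m + 1) → ℝ) 1,
    ∫ u : Fin (m + 1) → USphere m,
      subspaceDet (fun i => (addLast (u i : Euc m) (z i) : Euc (m + 1)))
      ∂Measure.pi fun _ => sphereMeasure m

theorem outerIntegral_nonneg : 0 ≤ outerIntegral m :=
  integral_nonneg fun _ => integral_nonneg fun _ => subspaceDet_nonneg _

theorem cylinderIntegral_one : cylinderIntegral m 1 = ENNReal.ofReal (outerIntegral m) := by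
  have hmp := measurePreserving_arrowProdEquivProdArrow (USphere m) ℝ (Fin (m + 1))
    (fun _ => sphereMeasure m) fun _ => (volume : Measure ℝ).restrict (Set.Icc (-1) 1)
  let g : (Fin (m + 1) → USphere m) × (Fin (m + 1) → ℝ) → ℝ := fun q =>
    subspaceDet fun i => (addLast (q.1 i : Euc m) (q.2 i) : Euc (m + 1))
  have hg : Continuous g := by
    refine continuous_subspaceDet fun i => ?_
    exact continuous_addLast.comp (by fun_prop : Continuous fun q :
      (Fin (m + 1) → USphere m) × (Fin (m + 1) → ℝ) => ((q.1 i : Euc m), q.2 i))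
  have hpi : (Measure.pi fun _ : Fin (m + 1) => (volume : Measure ℝ).restrict (Set.Icc (-1) 1)) =
      volume.restrict (Set.Icc (-1 : Fin (m + 1) → ℝ) 1) := by
    rw [← Measure.restrict_pi_pi, ← volume_pi]
    congr 1
    exact Set.pi_univ_Icc (-1 : Fin (m + 1) → ℝ) 1
  rw [hpi] at hmp
  have hint : Integrable g ((Measure.pi fun _ : Fin (m + 1) => sphereMeasure m).prod
      (volume.restrict (Set.Icc (-1 : Fin (m + 1) → ℝ) 1))) := by
    have h1 : ((Measure.pi fun _ : Fin (m + 1) => sphereMeasure m).prod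
        (volume.restrict (Set.Icc (-1 : Fin (m + 1) → ℝ) 1))) =
        ((Measure.pi fun _ : Fin (m + 1) => sphereMeasure m).prod volume).restrict
          (Set.univ ×ˢ Set.Icc (-1 : Fin (m + 1) → ℝ) 1) := by
      rw [← Measure.prod_restrict, Measure.restrict_univ]
    rw [h1]
    exact hg.continuousOn.integrableOn_compact (isCompact_univ.prod isCompact_Icc)
  have h2 : cylinderIntegral m 1 = ∫⁻ q, ENNReal.ofReal (g q)
      ∂((Measure.pi fun _ : Fin (m + 1) => sphereMeasure m).prod
      (volume.restrict (Set.Icc (-1 : Fin (m + 1) → ℝ) 1))) := by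
    rw [← hmp.lintegral_comp hg.measurable.ennreal_ofReal]
    rfl
  rw [h2, ← ofReal_integral_eq_lintegral_ofReal hint
    (Eventually.of_forall fun _ => subspaceDet_nonneg _), integral_prod_symm _ hint]
  rfl

theorem inner_sphereLift_single (p : USphere m × ℝ) (ρ : ℝ) :
    inner ℝ (sphereLift p : Euc (m + 1)) (EuclideanSpace.single (Fin.last m) ρ) =
      ρ * ((√(1 + p.2 ^ 2))⁻¹ * p.2) := by
  rw [EuclideanSpace.inner_single_right]
  simp [sphereLift, addLast]

/-- In cylindrical coordinates, the condition `|⟨u, ρ e_d⟩| ≤ R` reads `|z| ≤ k`. -/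
theorem abs_inner_sphereLift_le_iff (p : USphere m × ℝ) {ρ k : ℝ} (hρ : 0 < ρ) (hk : 0 ≤ k) :
    |inner ℝ (sphereLift p : Euc (m + 1)) (EuclideanSpace.single (Fin.last m) ρ)| ≤
      ρ * ((√(1 + k ^ 2))⁻¹ * k) ↔ |p.2| ≤ k := by
  have hz : 0 < √(1 + p.2 ^ 2) := Real.sqrt_pos.2 (by positivity)
  have hk' : 0 < √(1 + k ^ 2) := Real.sqrt_pos.2 (by positivity)
  rw [inner_sphereLift_single, abs_mul, abs_mul, abs_inv, abs_of_pos hρ, abs_of_pos hz,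
    mul_le_mul_iff_right₀ hρ, inv_mul_le_iff₀ hz, ← abs_of_nonneg hk, ← sq_abs p.2]
  rw [abs_of_nonneg hk]
  rw [← sq_le_sq₀ (abs_nonneg _) (by positivity), mul_pow, mul_pow, inv_pow,
    Real.sq_sqrt (by positivity), Real.sq_sqrt (by positivity), ← mul_assoc,
    ← sq_le_sq₀ (abs_nonneg _) hk, mul_comm (_ + _), inv_mul_eq_div, div_mul_eq_mul_div,
    le_div_iff₀ (by positivity)]
  constructor <;> intro h <;> nlinarith

theorem normalIntegral_eq_lintegral_cylinder (hm : 1 ≤ m) {ρ k : ℝ} (hρ : 0 < ρ) (hk : 0 ≤ k) :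
    normalIntegral (m + 1) (ρ * ((√(1 + k ^ 2))⁻¹ * k)) (EuclideanSpace.single (Fin.last m) ρ) =
      ∫⁻ p : Fin (m + 1) → USphere m × ℝ,
        ENNReal.ofReal ((∏ i, (√(1 + (p i).2 ^ 2))⁻¹) *
          subspaceDet fun i => (addLast ((p i).1 : Euc m) (p i).2 : Euc (m + 1)))
        ∂Measure.pi fun _ => (cylinderMeasure m k).withDensity fun p => liftWeight m p.2 := by
  have hl : Measurable (sphereLift (m := m)) := continuous_sphereLift.measurable
  have hlpi : Measurable fun (p : Fin (m + 1) → USphere m × ℝ) (i : Fin (m + 1)) =>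
      sphereLift (p i) :=
    measurable_pi_lambda _ fun i => hl.comp (measurable_pi_apply i)
  set τ := (sphereMeasure m).prod ((volume : Measure ℝ).withDensity (liftWeight m)) with hτ
  have hτf : IsFiniteMeasure τ := by
    refine ⟨?_⟩
    rw [← Set.preimage_univ (f := sphereLift), ← Measure.map_apply hl MeasurableSet.univ,
      map_sphereLift hm]
    exact measure_lt_top _ _
  have hpi : (Measure.pi fun _ : Fin (m + 1) => sphereMeasure (m + 1)) =
      (Measure.pi fun _ : Fin (m + 1) => τ).map fun p i => sphereLift (p i) := by
    have : IsFiniteMeasure (τ.map sphereLift) := Measure.isFiniteMeasure_map _ _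
    rw [Measure.pi_map_pi fun _ => hl.aemeasurable, map_sphereLift hm]
  rw [normalIntegral, hpi, lintegral_map (measurable_normalIntegrand_right _ _) hlpi,
    ← prod_withDensity_restrict, ← Measure.restrict_pi_pi, ← lintegral_indicator
      (MeasurableSet.univ_pi fun _ => MeasurableSet.univ.prod measurableSet_Icc)]
  refine lintegral_congr fun p => ?_
  have hpos : 0 ≤ ∏ i, (√(1 + (p i).2 ^ 2))⁻¹ := Finset.prod_nonneg fun i _ => by positivity
  have h2 := subspaceDet_smul (fun i => (√(1 + (p i).2 ^ 2))⁻¹)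
    fun i => (addLast ((p i).1 : Euc m) (p i).2 : Euc (m + 1))
  rw [abs_of_nonneg hpos] at h2
  have h3 : (fun i => sphereLift (p i)) ∈ {u : Fin (m + 1) → USphere (m + 1) | ∀ i,
      |inner ℝ (u i : Euc (m + 1)) (EuclideanSpace.single (Fin.last m) ρ)| ≤
        ρ * ((√(1 + k ^ 2))⁻¹ * k)} ↔ ∀ i, |(p i).2| ≤ k :=
    forall_congr' fun i => abs_inner_sphereLift_le_iff (p i) hρ hk
  have h4 : p ∈ Set.univ.pi (fun _ : Fin (m + 1) =>
      (Set.univ : Set (USphere m)) ×ˢ Set.Icc (-k) k) ↔ ∀ i, |(p i).2| ≤ k := by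
    simp [abs_le]
  by_cases h : ∀ i, |(p i).2| ≤ k
  · rw [Set.indicator_of_mem (h3.2 h), Set.indicator_of_mem (h4.2 h), ← h2]
    rfl
  · rw [Set.indicator_of_notMem (mt h3.1 h), Set.indicator_of_notMem (mt h4.1 h)]

theorem normalIntegral_le_cylinderIntegral (hm : 1 ≤ m) {ρ k : ℝ} (hρ : 0 < ρ) (hk : 0 ≤ k) :
    normalIntegral (m + 1) (ρ * ((√(1 + k ^ 2))⁻¹ * k)) (EuclideanSpace.single (Fin.last m) ρ) ≤
      cylinderIntegral m k := by
  rw [normalIntegral_eq_lintegral_cylinder hm hρ hk]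
  refine lintegral_mono' (pi_measure_mono fun _ => withDensity_liftWeight_le m k) fun p => ?_
  refine ENNReal.ofReal_le_ofReal (mul_le_of_le_one_left (subspaceDet_nonneg _) ?_)
  refine Finset.prod_le_one (fun i _ => by positivity) fun i _ => inv_le_one_of_one_le₀ ?_
  rw [Real.one_le_sqrt]
  nlinarith [sq_nonneg (p i).2]

theorem cylinderIntegral_le_normalIntegral (hm : 1 ≤ m) {ρ k : ℝ} (hρ : 0 < ρ) (hk : 0 ≤ k) :
    ENNReal.ofReal ((√(1 + k ^ 2))⁻¹ ^ ((m + 2) * (m + 1))) * cylinderIntegral m k ≤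
    normalIntegral (m + 1) (ρ * ((√(1 + k ^ 2))⁻¹ * k)) (EuclideanSpace.single (Fin.last m) ρ) := by
  rw [normalIntegral_eq_lintegral_cylinder hm hρ hk]
  have h1 : (∫⁻ p : Fin (m + 1) → USphere m × ℝ, ENNReal.ofReal ((√(1 + k ^ 2))⁻¹ ^ (m + 1)) *
      ENNReal.ofReal (subspaceDet fun i => (addLast ((p i).1 : Euc m) (p i).2 : Euc (m + 1)))
      ∂Measure.pi fun _ => liftWeight m k • cylinderMeasure m k) =
      ENNReal.ofReal ((√(1 + k ^ 2))⁻¹ ^ ((m + 2) * (m + 1))) * cylinderIntegral m k := by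
    rw [lintegral_const_mul _ continuous_subspaceDet_addLast.measurable.ennreal_ofReal,
      pi_smul_measure _ (c := liftWeight m k) ENNReal.ofReal_ne_top, lintegral_smul_measure,
      smul_eq_mul, ← mul_assoc,
      Fintype.card_fin, liftWeight, ← ENNReal.ofReal_pow (by positivity),
      ← ENNReal.ofReal_mul (by positivity), cylinderIntegral, ← pow_mul, ← pow_add]
    congr 3
    ring
  rw [← h1]
  have hc : ∀ᵐ p ∂Measure.pi fun _ : Fin (m + 1) => liftWeight m k • cylinderMeasure m k,
      ∀ i, |(p i).2| ≤ k := by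
    have : IsFiniteMeasure (liftWeight m k • cylinderMeasure m k) :=
      Measure.smul_finite _ ENNReal.ofReal_ne_top
    refine ae_all_iff.2 fun i => ?_
    exact (Measure.tendsto_eval_ae_ae (μ := fun _ : Fin (m + 1) =>
      liftWeight m k • cylinderMeasure m k) (i := i)).eventually
        (Measure.ae_smul_measure (ae_cylinderMeasure m k) _)
  refine (lintegral_mono_ae ?_).trans
    (lintegral_mono' (pi_measure_mono fun _ => le_withDensity_liftWeight m k) le_rfl)
  filter_upwards [hc] with p hp
  rw [← ENNReal.ofReal_mul (by positivity)]
  refine ENNReal.ofReal_le_ofReal (mul_le_mul_of_nonneg_right ?_ (subspaceDet_nonneg _))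
  calc (√(1 + k ^ 2))⁻¹ ^ (m + 1) = ∏ _i : Fin (m + 1), (√(1 + k ^ 2))⁻¹ := by simp
    _ ≤ ∏ i, (√(1 + (p i).2 ^ 2))⁻¹ :=
      Finset.prod_le_prod (fun i _ => by positivity) fun i _ => inv_sqrt_le_inv_sqrt (hp i)

end outer

section asymptotics

variable {m : ℕ}

/-- Two-sided estimate of `normalIntegral` at `R = ‖x‖ h`, from the comparison with
`cylinderIntegral` for `k = h / √(1 - h²)`. -/
theorem normalIntegral_bounds (hm : 1 ≤ m) {h : ℝ} (h0 : 0 < h) (h1 : h < 1) {x : Euc (m + 1)}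
    (hx : 0 < ‖x‖) :
    (√(1 - h ^ 2)) ^ ((m + 2) * m) * (h ^ (m + 2) * outerIntegral m) ≤
        (normalIntegral (m + 1) (‖x‖ * h) x).toReal ∧
      (normalIntegral (m + 1) (‖x‖ * h) x).toReal ≤
        (√(1 - h ^ 2))⁻¹ ^ (m + 2) * (h ^ (m + 2) * outerIntegral m) := by
  have hq : 0 < 1 - h ^ 2 := by nlinarith
  set s := √(1 - h ^ 2) with hs
  have hs0 : 0 < s := Real.sqrt_pos.2 hq
  have hs2 : s ^ 2 = 1 - h ^ 2 := Real.sq_sqrt hq.le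
  have hk : 0 < h / s := div_pos h0 hs0
  -- The coordinate `k = h / s` satisfies `√(1 + k²) = 1 / s`.
  have hsk : (√(1 + (h / s) ^ 2))⁻¹ = s := by
    have : 1 + (h / s) ^ 2 = (s⁻¹) ^ 2 := by
      field_simp
      linarith
    rw [this, Real.sqrt_sq (by positivity), inv_inv]
  have hxs : ‖x‖ = ‖(EuclideanSpace.single (Fin.last m) ‖x‖ : Euc (m + 1))‖ := by simp
  have hle := normalIntegral_le_cylinderIntegral hm hx hk.le
  have hge := cylinderIntegral_le_normalIntegral hm hx hk.le
  rw [hsk, mul_div_cancel₀ h hs0.ne', cylinderIntegral_eq hk, cylinderIntegral_one,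
    ← normalIntegral_congr_norm _ hxs, ← ENNReal.ofReal_mul (by positivity)] at hle hge
  have hI := outerIntegral_nonneg (m := m)
  rw [← ENNReal.ofReal_mul (by positivity)] at hge
  constructor
  · have h2 := (ENNReal.ofReal_le_iff_le_toReal (normalIntegral_ne_top _ _)).1 hge
    refine le_trans (le_of_eq ?_) h2
    rw [div_pow, Nat.mul_succ, pow_add]
    field_simp
    ring
  · refine (ENNReal.toReal_le_of_le_ofReal (by positivity) hle).trans (le_of_eq ?_)
    rw [div_pow, inv_pow]
    field_simp

theorem one_add_two_mul_pow_le {y : ℝ} (h0 : 0 ≤ y) (h1 : y ≤ 1) (n : ℕ) :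
    (1 + 2 * y) ^ n ≤ 1 + (3 ^ n - 1) * y := by
  induction n with
  | zero => simp
  | succ n ih =>
    have h3 : (1 : ℝ) ≤ 3 ^ n := one_le_pow₀ (by norm_num)
    have h4 : (3 ^ n - 1) * (y * y) ≤ (3 ^ n - 1) * (y * 1) := by
      gcongr
    calc (1 + 2 * y) ^ (n + 1) = (1 + 2 * y) ^ n * (1 + 2 * y) := pow_succ _ _
      _ ≤ (1 + (3 ^ n - 1) * y) * (1 + 2 * y) := by gcongr
      _ ≤ 1 + (3 ^ (n + 1) - 1) * y := by
        rw [pow_succ]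
        nlinarith

/-- The leading term of `normalIntegral` for `‖x‖ ≥ R`, with relative error `O((R / ‖x‖)²)`. -/
theorem exists_abs_normalIntegral_sub_le (hm : 1 ≤ m) :
    ∃ C : ℝ, 0 ≤ C ∧ ∀ (R : ℝ) (x : Euc (m + 1)), 0 < R → R ≤ ‖x‖ →
      |(normalIntegral (m + 1) R x).toReal - (R / ‖x‖) ^ (m + 2) * outerIntegral m| ≤
        (R / ‖x‖) ^ (m + 2) * (C * (R / ‖x‖) ^ 2) := by
  set I := outerIntegral m with hI
  have hI0 : 0 ≤ I := outerIntegral_nonneg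
  set J := ∫ u : Fin (m + 1) → USphere (m + 1),
    subspaceDet (fun i => (u i : Euc (m + 1))) ∂Measure.pi fun _ => sphereMeasure (m + 1) with hJ
  have hJ0 : 0 ≤ J := integral_nonneg fun _ => subspaceDet_nonneg _
  refine ⟨((m + 2) * m + 3 ^ (m + 2) : ℝ) * I + 2 ^ (m + 4) * (J + I), by positivity,
    fun R x hR hRx => ?_⟩
  have hx : 0 < ‖x‖ := hR.trans_le hRx
  set h := R / ‖x‖ with hh
  have h0 : 0 < h := div_pos hR hx
  have h1 : h ≤ 1 := (div_le_one hx).2 hRx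
  set A := (normalIntegral (m + 1) R x).toReal with hA
  have hA0 : 0 ≤ A := ENNReal.toReal_nonneg
  have hAJ : A ≤ J := ENNReal.toReal_le_of_le_ofReal hJ0 (normalIntegral_le R x)
  have hhm : 0 ≤ h ^ (m + 2) := by positivity
  -- For `h > 1/2` both terms are bounded and `2^{m+4} h^{m+4} ≥ 1`.
  rcases le_or_gt h (1 / 2) with hsmall | hlarge
  · have hb := normalIntegral_bounds hm h0 (by linarith) hx
    have hRh : ‖x‖ * h = R := by rw [hh, mul_div_cancel₀ R hx.ne']
    rw [hRh, ← hA, ← hI] at hb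
    have hq : 0 < 1 - h ^ 2 := by nlinarith
    have hsq : 1 - h ^ 2 ≤ √(1 - h ^ 2) := by
      rw [Real.le_sqrt' hq]
      nlinarith [sq_nonneg h]
    have hlow : 1 - ((m + 2) * m : ℝ) * h ^ 2 ≤ √(1 - h ^ 2) ^ ((m + 2) * m) := by
      have h2 := one_add_mul_le_pow (a := -h ^ 2) (by nlinarith) ((m + 2) * m)
      push_cast at h2
      calc 1 - ((m + 2) * m : ℝ) * h ^ 2 = 1 + ((m + 2) * m : ℝ) * -h ^ 2 := by ring
        _ ≤ (1 + -h ^ 2) ^ ((m + 2) * m) := h2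
        _ ≤ _ := pow_le_pow_left₀ (by linarith) (by linarith) _
    have hinv : (√(1 - h ^ 2))⁻¹ ≤ 1 + 2 * h ^ 2 := by
      refine (inv_anti₀ hq hsq).trans ?_
      rw [inv_le_iff_one_le_mul₀ hq]
      have h4 : 0 ≤ 1 - 2 * h ^ 2 := by nlinarith
      nlinarith [mul_nonneg (sq_nonneg h) h4]
    have hupp : (√(1 - h ^ 2))⁻¹ ^ (m + 2) ≤ 1 + 3 ^ (m + 2) * h ^ 2 := by
      refine (pow_le_pow_left₀ (by positivity) hinv _).trans ?_
      refine (one_add_two_mul_pow_le (sq_nonneg h) (by nlinarith) _).trans ?_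
      nlinarith [sq_nonneg h]
    have hy : 0 ≤ h ^ (m + 2) * I := by positivity
    have e1 := mul_le_mul_of_nonneg_right hlow hy
    have e2 := mul_le_mul_of_nonneg_right hupp hy
    have e3 : 0 ≤ h ^ (m + 2) * I * ((m + 2) * m * h ^ 2) := by positivity
    have e4 : 0 ≤ h ^ (m + 2) * I * (3 ^ (m + 2) * h ^ 2) := by positivity
    have e5 : 0 ≤ h ^ (m + 2) * (2 ^ (m + 4) * (J + I) * h ^ 2) := by positivity
    have e6 := e1.trans hb.1
    have e7 := hb.2.trans e2
    rw [abs_le]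
    constructor <;> linarith
  · have e1 : |A - h ^ (m + 2) * I| ≤ J + I := by
      have : h ^ (m + 2) * I ≤ 1 * I := mul_le_mul_of_nonneg_right (pow_le_one₀ h0.le h1) hI0
      rw [abs_le]
      constructor <;> nlinarith [mul_nonneg hhm hI0]
    have e2 : 1 ≤ 2 ^ (m + 4) * h ^ (m + 4) := by
      rw [← mul_pow]
      exact one_le_pow₀ (by linarith)
    have e3 : 0 ≤ h ^ (m + 2) * (((m + 2) * m + 3 ^ (m + 2) : ℝ) * I * h ^ 2) := by positivity
    have e4 := mul_le_mul_of_nonneg_right e2 (add_nonneg hJ0 hI0)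
    have e5 : h ^ (m + 4) = h ^ (m + 2) * h ^ 2 := by rw [← pow_add]
    rw [e5] at e4
    linarith

/-- The expansion of the density outside `B_R`. -/
theorem exists_abs_intersectionDensity_sub_le {d : ℕ} (hd : 2 ≤ d) :
    ∃ C : ℝ, 0 ≤ C ∧ ∀ (t R : ℝ) (x : Euc d), 0 < t → 0 < R → R ≤ ‖x‖ →
      |intersectionDensity d t R x -
        (R / ‖x‖) ^ (d + 1) * t ^ d * (outerConst d / (Nat.factorial d : ℝ))| ≤
      (R / ‖x‖) ^ (d + 1) * t ^ d * (C * (R ^ 2 / ‖x‖ ^ 2)) := by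
  obtain ⟨m, rfl⟩ : ∃ m, d = m + 1 := ⟨d - 1, by omega⟩
  obtain ⟨C, hC, h⟩ := exists_abs_normalIntegral_sub_le (m := m) (by omega)
  have hω := sphereArea_pos (d := m + 1) (by omega)
  have hw : 0 ≤ (sphereArea (m + 1) ^ (m + 1))⁻¹ / (Nat.factorial (m + 1) : ℝ) := by positivity
  refine ⟨(sphereArea (m + 1) ^ (m + 1))⁻¹ / (Nat.factorial (m + 1) : ℝ) * C, by positivity,
    fun t R x ht hR hRx => ?_⟩
  have houter : outerConst (m + 1) = (sphereArea (m + 1) ^ (m + 1))⁻¹ * outerIntegral m := rfl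
  set w := (sphereArea (m + 1) ^ (m + 1))⁻¹ / (Nat.factorial (m + 1) : ℝ) with hwdef
  have e1 : intersectionDensity (m + 1) t R x -
      (R / ‖x‖) ^ (m + 1 + 1) * t ^ (m + 1) * (outerConst (m + 1) / (Nat.factorial (m + 1) : ℝ)) =
      (w * t ^ (m + 1)) * ((normalIntegral (m + 1) R x).toReal -
        (R / ‖x‖) ^ (m + 2) * outerIntegral m) := by
    rw [houter, intersectionDensity, div_pow, hwdef]
    ring
  have hwt : 0 ≤ w * t ^ (m + 1) := by positivity
  rw [e1, abs_mul, abs_of_nonneg hwt]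
  refine (mul_le_mul_of_nonneg_left (h R x hR hRx) hwt).trans (le_of_eq ?_)
  rw [← div_pow]
  ring

end asymptotics

/-! ### Total variation outside a ball -/

theorem tvDistance_restrict_withDensity_le {X : Type*} [MeasurableSpace X] {μ : Measure X}
    {S : Set X} (hS : MeasurableSet S) {f g e : X → ℝ} (hf : IntegrableOn f S μ)
    (hg : IntegrableOn g S μ) (he : IntegrableOn e S μ) (hf0 : ∀ x, 0 ≤ f x) (hg0 : ∀ x, 0 ≤ g x)
    (hfg : ∀ x ∈ S, |f x - g x| ≤ e x) :
    tvDistance ((μ.withDensity fun x => ENNReal.ofReal (f x)).restrict S)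
      ((μ.withDensity fun x => ENNReal.ofReal (g x)).restrict S) ≤
        ENNReal.ofReal (∫ x in S, e x ∂μ) := by
  refine iSup₂_le fun A hA => ENNReal.ofReal_le_ofReal ?_
  have key : ∀ {φ : X → ℝ}, IntegrableOn φ S μ → (∀ x, 0 ≤ φ x) →
      ((μ.withDensity fun x => ENNReal.ofReal (φ x)).restrict S).real A = ∫ x in A ∩ S, φ x ∂μ := by
    intro φ hφ hφ0
    rw [measureReal_def, Measure.restrict_apply hA, withDensity_apply _ (hA.inter hS),
      integral_eq_lintegral_of_nonneg_ae (Eventually.of_forall hφ0)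
        (hφ.mono_set Set.inter_subset_right).aestronglyMeasurable]
  have hAS : A ∩ S ⊆ S := Set.inter_subset_right
  rw [key hf hf0, key hg hg0, ← integral_sub (hf.mono_set hAS) (hg.mono_set hAS)]
  have he0 : 0 ≤ᵐ[μ.restrict S] e := by
    filter_upwards [ae_restrict_mem hS] with x hx
    exact (abs_nonneg _).trans (hfg x hx)
  calc |∫ x in A ∩ S, f x - g x ∂μ| ≤ ∫ x in A ∩ S, |f x - g x| ∂μ := abs_integral_le_integral_abs
    _ ≤ ∫ x in A ∩ S, e x ∂μ :=
      setIntegral_mono_on ((hf.mono_set hAS).sub (hg.mono_set hAS)).abs (he.mono_set hAS)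
        (hA.inter hS) fun x hx => hfg x hx.2
    _ ≤ ∫ x in S, e x ∂μ := setIntegral_mono_set he he0 (Eventually.of_forall hAS)

section radial

variable {d : ℕ}

theorem radial_integrand_eq (hd : 1 ≤ d) {n : ℕ} {r y : ℝ} (hy : y ∈ Set.Ioi (0 : ℝ)) :
    y ^ (d - 1) * (Set.Ioi r).indicator (fun y => (y ^ (d + n))⁻¹) y =
      (Set.Ioi r).indicator (fun y => y ^ (-(n + 1 : ℝ))) y := by
  have hy : 0 < y := hy
  by_cases h : y ∈ Set.Ioi r
  · rw [Set.indicator_of_mem h, Set.indicator_of_mem h, Real.rpow_neg hy.le]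
    have : y ^ (d + n) = y ^ (d - 1) * y ^ (n + 1) := by
      rw [← pow_add]
      congr 1
      omega
    rw [this, mul_inv, mul_inv_cancel_left₀ (by positivity)]
    congr 1
    exact_mod_cast (Real.rpow_natCast y (n + 1)).symm
  · simp [Set.indicator_of_notMem h]

theorem indicator_compl_closedBall (n : ℕ) (r : ℝ) :
    ((Metric.closedBall (0 : Euc d) r)ᶜ).indicator (fun x => (‖x‖ ^ (d + n))⁻¹) =
      fun x => (Set.Ioi r).indicator (fun y => (y ^ (d + n))⁻¹) ‖x‖ := by
  ext x
  have hmem : x ∈ (Metric.closedBall (0 : Euc d) r)ᶜ ↔ ‖x‖ ∈ Set.Ioi r := by simp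
  by_cases h : ‖x‖ ∈ Set.Ioi r
  · rw [Set.indicator_of_mem (hmem.2 h), Set.indicator_of_mem h]
  · rw [Set.indicator_of_notMem (mt hmem.1 h), Set.indicator_of_notMem h]

theorem integrableOn_compl_closedBall (hd : 1 ≤ d) {n : ℕ} (hn : 1 ≤ n) {r : ℝ} (hr : 0 < r) :
    IntegrableOn (fun x : Euc d => (‖x‖ ^ (d + n))⁻¹) (Metric.closedBall (0 : Euc d) r)ᶜ := by
  have : Nonempty (Fin d) := ⟨⟨0, hd⟩⟩
  rw [← integrable_indicator_iff Metric.isClosed_closedBall.measurableSet.compl,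
    indicator_compl_closedBall, integrable_fun_norm_addHaar, finrank_euclideanSpace_fin]
  simp_rw [smul_eq_mul]
  rw [integrableOn_congr_fun (fun y hy => radial_integrand_eq hd hy) measurableSet_Ioi]
  refine Integrable.integrableOn ?_
  rw [integrable_indicator_iff measurableSet_Ioi]
  have : (1 : ℝ) ≤ n := by exact_mod_cast hn
  exact integrableOn_Ioi_rpow_of_lt (by linarith) hr

theorem integral_compl_closedBall (hd : 1 ≤ d) {n : ℕ} (hn : 1 ≤ n) {r : ℝ} (hr : 0 < r) :
    ∫ x in (Metric.closedBall (0 : Euc d) r)ᶜ, (‖x‖ ^ (d + n))⁻¹ =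
      sphereArea d * ((r ^ n)⁻¹ / n) := by
  have : Nonempty (Fin d) := ⟨⟨0, hd⟩⟩
  have hn' : (1 : ℝ) ≤ n := by exact_mod_cast hn
  rw [← integral_indicator Metric.isClosed_closedBall.measurableSet.compl,
    indicator_compl_closedBall, integral_fun_norm_addHaar, finrank_euclideanSpace_fin]
  simp_rw [smul_eq_mul]
  rw [setIntegral_congr_fun measurableSet_Ioi fun y hy => radial_integrand_eq hd hy,
    setIntegral_indicator measurableSet_Ioi, Set.inter_eq_right.2 (Set.Ioi_subset_Ioi hr.le),
    integral_Ioi_rpow_of_lt (by linarith) hr, sphereArea, sphereMeasure,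
    Measure.toSphere_real_apply_univ, finrank_euclideanSpace_fin, nsmul_eq_mul, mul_assoc]
  congr 2
  have h1 : -((n : ℝ) + 1) + 1 = -n := by ring
  rw [h1, Real.rpow_neg hr.le, Real.rpow_natCast, neg_div_neg_eq]

end radial

section critical

theorem critRadius_pos (d : ℕ) {t : ℝ} (ht : 0 < t) : 0 < critRadius d t :=
  Real.rpow_pos_of_pos ht _

theorem critRadius_pow_mul (d : ℕ) {t : ℝ} (ht : 0 < t) :
    critRadius d t ^ (d + 1) * t ^ d = 1 := by
  rw [critRadius, ← Real.rpow_natCast, ← Real.rpow_mul ht.le, ← Real.rpow_natCast t d,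
    ← Real.rpow_add ht]
  have : -((d : ℝ) / ((d : ℝ) + 1)) * ((d + 1 : ℕ) : ℝ) + d = 0 := by
    push_cast
    field_simp
    ring
  rw [this, Real.rpow_zero]

theorem critRadius_sq (d : ℕ) {t : ℝ} (ht : 0 < t) :
    critRadius d t ^ 2 = t ^ (-(2 * (d : ℝ) / ((d : ℝ) + 1))) := by
  rw [critRadius, ← Real.rpow_natCast, ← Real.rpow_mul ht.le]
  congr 1
  push_cast
  ring

theorem tendsto_critRadius {d : ℕ} (hd : 1 ≤ d) : Tendsto (critRadius d) atTop (𝓝 0) := by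
  have : (0 : ℝ) < d := by exact_mod_cast hd
  exact tendsto_rpow_neg_atTop (by positivity)

theorem outerConst_nonneg (d : ℕ) : 0 ≤ outerConst d := by
  have : 0 ≤ sphereArea d := ENNReal.toReal_nonneg
  exact mul_nonneg (by positivity) (integral_nonneg fun _ => integral_nonneg fun _ =>
    subspaceDet_nonneg _)

theorem limitConst_nonneg (d : ℕ) : 0 ≤ limitConst d :=
  div_nonneg (outerConst_nonneg d) (Nat.cast_nonneg _)

variable {d : ℕ} {C : ℝ}

/-- At the critical radius, the expansion of the density compares it with the density of `M`. -/
theorem abs_intersectionDensity_critRadius_sub_le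
    (hC : ∀ (t R : ℝ) (x : Euc d), 0 < t → 0 < R → R ≤ ‖x‖ →
      |intersectionDensity d t R x -
        (R / ‖x‖) ^ (d + 1) * t ^ d * (outerConst d / (Nat.factorial d : ℝ))| ≤
      (R / ‖x‖) ^ (d + 1) * t ^ d * (C * (R ^ 2 / ‖x‖ ^ 2)))
    {t : ℝ} (ht : 0 < t) {x : Euc d} (hx : critRadius d t ≤ ‖x‖) :
    |intersectionDensity d t (critRadius d t) x - limitConst d / ‖x‖ ^ (d + 1)| ≤
      C * critRadius d t ^ 2 * (‖x‖ ^ (d + 3))⁻¹ := by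
  have hR := critRadius_pos d ht
  have hx0 : 0 < ‖x‖ := hR.trans_le hx
  have h1 : (critRadius d t / ‖x‖) ^ (d + 1) * t ^ d = (‖x‖ ^ (d + 1))⁻¹ := by
    rw [div_pow, div_mul_eq_mul_div, critRadius_pow_mul d ht, one_div]
  have h2 := hC t _ x ht hR hx
  rw [h1] at h2
  have h3 : limitConst d / ‖x‖ ^ (d + 1) =
      (‖x‖ ^ (d + 1))⁻¹ * (outerConst d / (Nat.factorial d : ℝ)) := by
    rw [limitConst]
    ring
  rw [h3]
  refine h2.trans (le_of_eq ?_)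
  have : ‖x‖ ^ (d + 3) = ‖x‖ ^ (d + 1) * ‖x‖ ^ 2 := by rw [← pow_add]
  rw [this, mul_inv]
  ring

theorem integrableOn_limitDensity (hd : 1 ≤ d) {r : ℝ} (hr : 0 < r) :
    IntegrableOn (fun x : Euc d => limitConst d / ‖x‖ ^ (d + 1))
      (Metric.closedBall (0 : Euc d) r)ᶜ := by
  simp_rw [div_eq_mul_inv]
  exact (integrableOn_compl_closedBall hd le_rfl hr).const_mul _

theorem isFiniteMeasure_restrict_withDensity {X : Type*} [MeasurableSpace X] {μ : Measure X}
    {S : Set X} (hS : MeasurableSet S) {f : X → ℝ} (hf : IntegrableOn f S μ) :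
    IsFiniteMeasure ((μ.withDensity fun x => ENNReal.ofReal (f x)).restrict S) := by
  rw [restrict_withDensity hS]
  exact isFiniteMeasure_withDensity_ofReal hf.2

theorem tvDistance_critRadius_le (hd : 1 ≤ d)
    (hC : ∀ (t R : ℝ) (x : Euc d), 0 < t → 0 < R → R ≤ ‖x‖ →
      |intersectionDensity d t R x -
        (R / ‖x‖) ^ (d + 1) * t ^ d * (outerConst d / (Nat.factorial d : ℝ))| ≤
      (R / ‖x‖) ^ (d + 1) * t ^ d * (C * (R ^ 2 / ‖x‖ ^ 2)))
    {t r : ℝ} (ht : 0 < t) (hr : 0 < r) (htr : critRadius d t < r) :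
    IsFiniteMeasure ((volume.withDensity fun x => ENNReal.ofReal
        (intersectionDensity d t (critRadius d t) x)).restrict (Metric.closedBall (0 : Euc d) r)ᶜ) ∧
      IsFiniteMeasure ((limitMeasure d).restrict (Metric.closedBall (0 : Euc d) r)ᶜ) ∧
      tvDistance
        ((volume.withDensity fun x => ENNReal.ofReal
          (intersectionDensity d t (critRadius d t) x)).restrict (Metric.closedBall (0 : Euc d) r)ᶜ)
        ((limitMeasure d).restrict (Metric.closedBall (0 : Euc d) r)ᶜ) ≤
          ENNReal.ofReal (C * sphereArea d / 3 * t ^ (-(2 * (d : ℝ) / ((d : ℝ) + 1))) *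
            (r ^ 3)⁻¹) := by
  have hS : MeasurableSet (Metric.closedBall (0 : Euc d) r)ᶜ :=
    Metric.isClosed_closedBall.measurableSet.compl
  have hxS : ∀ x ∈ (Metric.closedBall (0 : Euc d) r)ᶜ, critRadius d t ≤ ‖x‖ := by
    intro x hx
    have : r < ‖x‖ := by simpa using hx
    exact (htr.trans this).le
  have hg := integrableOn_limitDensity hd hr
  have he : IntegrableOn (fun x : Euc d => C * critRadius d t ^ 2 * (‖x‖ ^ (d + 3))⁻¹)
      (Metric.closedBall (0 : Euc d) r)ᶜ :=
    (integrableOn_compl_closedBall hd (by norm_num) hr).const_mul _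
  have hf : IntegrableOn (intersectionDensity d t (critRadius d t))
      (Metric.closedBall (0 : Euc d) r)ᶜ := by
    refine (hg.add he).mono' (measurable_intersectionDensity _ _).aestronglyMeasurable ?_
    filter_upwards [ae_restrict_mem hS] with x hx
    have h1 := abs_intersectionDensity_critRadius_sub_le hC ht (hxS x hx)
    rw [Real.norm_eq_abs, abs_of_nonneg (intersectionDensity_nonneg ht.le _ _)]
    have h2 := (abs_le.1 h1).2
    simp only [Pi.add_apply]
    linarith
  refine ⟨isFiniteMeasure_restrict_withDensity hS hf,
    isFiniteMeasure_restrict_withDensity hS hg, ?_⟩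
  refine (tvDistance_restrict_withDensity_le hS hf hg he
    (fun x => intersectionDensity_nonneg ht.le _ x)
    (fun x => div_nonneg (limitConst_nonneg d) (by positivity))
    fun x hx => abs_intersectionDensity_critRadius_sub_le hC ht (hxS x hx)).trans ?_
  rw [integral_const_mul, integral_compl_closedBall hd (by norm_num) hr, critRadius_sq d ht]
  refine ENNReal.ofReal_le_ofReal (le_of_eq ?_)
  push_cast
  ring

end critical

theorem corollary4p2 (d : ℕ) (hd : 2 ≤ d) :
    ∃ C : ℝ, 0 < C ∧ ∃ f : ℝ → ℝ → Euc d → ℝ,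
      -- `f t R` is a nonnegative measurable function with the stated asymptotic expansion
      (∀ t R : ℝ, 0 < t → 0 < R →
        Measurable (f t R) ∧ (∀ x, 0 ≤ f t R x) ∧
        (∀ x : Euc d, x ≠ 0 → ‖x‖ < R →
          f t R x = innerConst d / (Nat.factorial d : ℝ) * t ^ d) ∧
        (∀ x : Euc d, R ≤ ‖x‖ →
          |f t R x - (R / ‖x‖) ^ (d + 1) * t ^ d * (outerConst d / (Nat.factorial d : ℝ))| ≤
            (R / ‖x‖) ^ (d + 1) * t ^ d * (C * (R ^ 2 / ‖x‖ ^ 2)))) ∧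
      -- pointwise convergence
      (∀ x : Euc d, x ≠ 0 →
        Tendsto (fun t : ℝ => f t (critRadius d t) x) atTop (𝓝 (limitConst d / ‖x‖ ^ (d + 1)))) ∧
      -- the density and the total variation bound, for each Poisson hyperplane process
      (∀ (Ω : Type*) [MeasurableSpace Ω] (P : Measure Ω) [IsProbabilityMeasure P] (t : ℝ)
        (η : Ω → Set (AffHyperplane d)), 0 < t → IsPoissonHyperplaneProcess P t η →
        (∀ R : ℝ, 0 < R →
          AEMeasurable (intersectionProcess η R) P ∧
          intensityMeasure P (intersectionProcess η R) =
            volume.withDensity fun x => ENNReal.ofReal (f t R x)) ∧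
        (∀ r : ℝ, 0 < r → critRadius d t < r →
          IsFiniteMeasure ((intensityMeasure P (intersectionProcess η (critRadius d t))).restrict
            (Metric.closedBall (0 : Euc d) r)ᶜ) ∧
          IsFiniteMeasure ((limitMeasure d).restrict (Metric.closedBall (0 : Euc d) r)ᶜ) ∧
          tvDistance
            ((intensityMeasure P (intersectionProcess η (critRadius d t))).restrict
              (Metric.closedBall (0 : Euc d) r)ᶜ)
            ((limitMeasure d).restrict (Metric.closedBall (0 : Euc d) r)ᶜ) ≤
              ENNReal.ofReal (C * t ^ (-(2 * (d : ℝ) / ((d : ℝ) + 1))) * (r ^ 3)⁻¹))) ∧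
      -- convergence in total variation, for each family of Poisson hyperplane processes
      (∀ (Ω : ℝ → Type*) [∀ t, MeasurableSpace (Ω t)]
        (P : ∀ t, Measure (Ω t)) [∀ t, IsProbabilityMeasure (P t)]
        (η : ∀ t, Ω t → Set (AffHyperplane d)),
        (∀ t : ℝ, 0 < t → IsPoissonHyperplaneProcess (P t) t (η t)) →
        ∀ r : ℝ, 0 < r →
          Tendsto (fun t : ℝ => tvDistance
              ((intensityMeasure (P t) (intersectionProcess (η t) (critRadius d t))).restrict
                (Metric.closedBall (0 : Euc d) r)ᶜ)
              ((limitMeasure d).restrict (Metric.closedBall (0 : Euc d) r)ᶜ)) atTop (𝓝 0)) := by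

  have hd1 : 1 ≤ d := by omega
  obtain ⟨C₀, hC₀, hexp⟩ := exists_abs_intersectionDensity_sub_le hd
  have hω := sphereArea_pos hd1
  have hωC : 0 ≤ C₀ * sphereArea d := by positivity
  set C : ℝ := C₀ + C₀ * sphereArea d + 1 with hCdef
  have hCC : C₀ ≤ C := by linarith
  have hC0 : 0 < C := by linarith
  have hexpC : ∀ (t R : ℝ) (x : Euc d), 0 < t → 0 < R → R ≤ ‖x‖ →
      |intersectionDensity d t R x -
        (R / ‖x‖) ^ (d + 1) * t ^ d * (outerConst d / (Nat.factorial d : ℝ))| ≤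
      (R / ‖x‖) ^ (d + 1) * t ^ d * (C * (R ^ 2 / ‖x‖ ^ 2)) := by
    intro t R x ht hR hx
    refine (hexp t R x ht hR hx).trans ?_
    gcongr
  have htv : ∀ {t r : ℝ}, 0 < t → 0 < r →
      ENNReal.ofReal (C₀ * sphereArea d / 3 * t ^ (-(2 * (d : ℝ) / ((d : ℝ) + 1))) * (r ^ 3)⁻¹) ≤
      ENNReal.ofReal (C * t ^ (-(2 * (d : ℝ) / ((d : ℝ) + 1))) * (r ^ 3)⁻¹) := by
    intro t r ht hr
    have : C₀ * sphereArea d / 3 ≤ C := by linarith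
    gcongr
  refine ⟨C, hC0, intersectionDensity d, fun t R ht hR => ⟨measurable_intersectionDensity t R,
    intersectionDensity_nonneg ht.le R, fun x _ hx => intersectionDensity_of_norm_le t hx.le,
    fun x hx => hexpC t R x ht hR hx⟩, fun x hx => ?_, ?_, ?_⟩
  · have hx0 : 0 < ‖x‖ := norm_pos_iff.2 hx
    rw [tendsto_iff_norm_sub_tendsto_zero]
    have hlim : Tendsto (fun t => C * critRadius d t ^ 2 * (‖x‖ ^ (d + 3))⁻¹) atTop (𝓝 0) := by
      have := (((tendsto_critRadius hd1).pow 2).const_mul C).mul_const (‖x‖ ^ (d + 3))⁻¹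
      simpa using this
    refine squeeze_zero' (Eventually.of_forall fun _ => norm_nonneg _) ?_ hlim
    filter_upwards [eventually_gt_atTop 0, (tendsto_critRadius hd1).eventually (gt_mem_nhds hx0)]
      with t ht htx
    exact abs_intersectionDensity_critRadius_sub_le hexpC ht htx.le
  · intro Ω _ P _ t η ht hη
    refine ⟨fun R _ => intersectionProcess_intensity hd1 ht hη R, fun r hr htr => ?_⟩
    rw [(intersectionProcess_intensity hd1 ht hη _).2]
    have h := tvDistance_critRadius_le hd1 hexp ht hr htr
    exact ⟨h.1, h.2.1, h.2.2.trans (htv ht hr)⟩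
  · intro Ω _ P _ η hη r hr
    have hlim : Tendsto (fun t => ENNReal.ofReal (C₀ * sphereArea d / 3 * critRadius d t ^ 2 *
        (r ^ 3)⁻¹)) atTop (𝓝 0) := by
      have := (((tendsto_critRadius hd1).pow 2).const_mul (C₀ * sphereArea d / 3)).mul_const
        (r ^ 3)⁻¹
      simpa using ENNReal.tendsto_ofReal this
    refine tendsto_of_tendsto_of_tendsto_of_le_of_le' tendsto_const_nhds hlim
      (Eventually.of_forall fun _ => zero_le) ?_
    filter_upwards [eventually_gt_atTop 0, (tendsto_critRadius hd1).eventually (gt_mem_nhds hr)]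
      with t ht htr
    rw [(intersectionProcess_intensity hd1 ht (hη t ht) _).2, critRadius_sq d ht]
    exact (tvDistance_critRadius_le hd1 hexp ht hr htr).2.2
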